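/- Let $\mu,\lambda>0$ and let $X_1,X_2,\ldots$ be i.i.d. with the inverse Gaussian distribution $\mathrm{IG}(\mu,\lambda)$, i.e. with density $$\phi(x)=\sqrt{\tfrac{\lambda}{2\pi}}\,e^{\lambda/\mu}\,x^{-3/2}\exp\!\Big(-\tfrac{\lambda}{2\mu}\big(\tfrac{x}{\mu}+\tfrac{\mu}{x}\big)\Big)\ \text{ for } x>0,\qquad \phi(x)=0 \text{ otherwise}.$$ Write $\overline{h(X)}=\frac1n\sum_{i=1}^n h(X_i)$, $\overline X=\frac1n\sum_{i=1}^n X_i$, $S^2=\frac1n\sum_{i=1}^n (X_i-\overline X)^2$, and for a differentiable weight function $f$ let $$\hat\lambda_f=\frac{\overline X^2\big(2\,\overline{X^2f'(X)}+\overline{Xf(X)}\big)}{\overline{X^2f(X)}-\overline X^2\,\overline{f(X)}}=g(\overline{Z}),\qquad g(z_1,\dots,z_5)=\frac{z_1^2(2z_5+z_3)}{z_4-z_1^2z_2},$$ where $\overline Z$ is the sample mean of the vectors $Z_i=\big(X_i,f(X_i),X_if(X_i),X_i^2f(X_i),X_i^2f'(X_i)\big)$. Then for $f\equiv1$, $\hat\lambda_f$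 is the ordinary moment estimator $\hat\lambda_{\mathrm{MM}}=\overline X^3/S^2$, and the following hold. 1. $\hat\lambda_{\mathrm{MM}}$ is asymptotically normal with asymptotic variance $\frac2n\lambda(\lambda+3\mu)$: $$\sqrt n\,(\hat\lambda_{\mathrm{MM}}-\lambda)\ \xrightarrow{d}\ \mathrm N\big(0,\,2\lambda(\lambda+3\mu)\big)\qquad(n\to\infty).$$ 2. Its asymptotic bias is $\frac3n(\lambda+3\mu)$, in both of the following senses. With $\mu_Z=\mathbb E[Z_1]$ (for $f\equiv 1$), and $D$, $H$ the gradient and Hessian of $g$ at $\mu_Z$, the second-order Taylor approximation of $\hat\lambda_{\mathrm{MM}}-\lambda$ is integrable and satisfies, for every $n\ge1$, $$\mathbb E\Big[D(\overline Z-\mu_Z)+\tfrac12(\overline Z-\mu_Z)^\top H(\overline Z-\mu_Z)\Big]=\frac3n(\lambda+3\mu).$$ Moreover, $\hat\lambda_{\mathrm{MM}}$ is integrable for all sufficiently large $n$, and $$\mathbb E[\hat\lambda_{\mathrm{MM}}]-\lambda=\frac3n(\lambda+3\mu)+o\!\left(\tfrac1n\right)\qquad(n\to\infty).$$ -/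

import Mathlib

open MeasureTheory ProbabilityTheory Filter Topology
open scoped ENNReal NNReal

noncomputable section

/-- Density of the inverse Gaussian distribution `IG(μ, lam)` with respect to Lebesgue measure. -/
def igPDF (μ lam x : ℝ) : ℝ :=
  if 0 < x then
    Real.sqrt (lam / (2 * Real.pi)) * Real.exp (lam / μ) * x ^ (-(3 / 2 : ℝ)) *
      Real.exp (-(lam / (2 * μ)) * (x / μ + μ / x))
  else 0

/-- The inverse Gaussian distribution `IG(μ, lam)`. -/
def igMeasure (μ lam : ℝ) : Measure ℝ :=
  volume.withDensity fun x => ENNReal.ofReal (igPDF μ lam x)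

/-- The sample mean of `h(x_0), …, h(x_{n-1})`. -/
def sampleMean (h : ℝ → ℝ) (n : ℕ) (x : ℕ → ℝ) : ℝ :=
  (∑ i ∈ Finset.range n, h (x i)) / n

/-- The empirical variance `S²` (with divisor `n`) of `x_0, …, x_{n-1}`. -/
def empiricalVariance (n : ℕ) (x : ℕ → ℝ) : ℝ :=
  sampleMean (fun t => (t - sampleMean id n x) ^ 2) n x

/-- The ordinary moment estimator `X̄³ / S²` of the parameter `lam`. -/
def mmEstimator (n : ℕ) (x : ℕ → ℝ) : ℝ :=
  sampleMean id n x ^ 3 / empiricalVariance n x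

/-- The Stein-type moment estimator of `lam` with weight function `f`. -/
def steinEstimator (f : ℝ → ℝ) (n : ℕ) (x : ℕ → ℝ) : ℝ :=
  sampleMean id n x ^ 2 *
      (2 * sampleMean (fun t => t ^ 2 * deriv f t) n x + sampleMean (fun t => t * f t) n x) /
    (sampleMean (fun t => t ^ 2 * f t) n x - sampleMean id n x ^ 2 * sampleMean f n x)

/-- The vector of statistics `(x, f x, x f x, x² f x, x² f' x)`. -/
def steinZ (f : ℝ → ℝ) (x : ℝ) : Fin 5 → ℝ :=
  ![x, f x, x * f x, x ^ 2 * f x, x ^ 2 * deriv f x]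

/-- The function expressing the Stein-type estimator through the sample mean of `steinZ f`. -/
def steinG (z : Fin 5 → ℝ) : ℝ :=
  z 0 ^ 2 * (2 * z 4 + z 2) / (z 3 - z 0 ^ 2 * z 1)

/-- The sample mean vector of `steinZ f`. -/
def steinZMean (f : ℝ → ℝ) (n : ℕ) (x : ℕ → ℝ) : Fin 5 → ℝ :=
  fun j => sampleMean (fun t => steinZ f t j) n x

/-- The expectation of `steinZ f X` for `X ∼ IG(μ, lam)`. -/
def steinZExp (f : ℝ → ℝ) (μ lam : ℝ) : Fin 5 → ℝ :=
  fun j => ∫ t, steinZ f t j ∂(igMeasure μ lam)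

theorem steinEstimator_eq (f : ℝ → ℝ) (n : ℕ) (x : ℕ → ℝ) :
    steinEstimator f n x = steinG (steinZMean f n x) := rfl

/-- The second-order Taylor term `D v + ½ vᵀ H v` of `g` at `a` with increment `v`, where `D` is
the gradient and `H` the Hessian of `g` at `a`. -/
def taylorTwo (g : (Fin 5 → ℝ) → ℝ) (a v : Fin 5 → ℝ) : ℝ :=
  fderiv ℝ g a v + (1 / 2) * fderiv ℝ (fderiv ℝ g) a v v

/-- The second-order Taylor approximation of the estimation error of the Stein-type estimator,
for `IG(μ, lam)` data; its expectation is the (second-order) asymptotic bias. -/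
def steinTaylorError (f : ℝ → ℝ) (μ lam : ℝ) (n : ℕ) (x : ℕ → ℝ) : ℝ :=
  taylorTwo steinG (steinZExp f μ lam) (steinZMean f n x - steinZExp f μ lam)

end

/-! Write `w` for the mean of `X_i - μ`, `q` for the mean of `(X_i - μ)² - σ²`, where `σ² = μ³ /
lam`, and `v = σ² + q - w²` for the empirical variance. The estimator is `(μ + w)³ / v`, and `lam *
σ² = μ³` makes its error `N / v`, with `N` a polynomial in `w, q` vanishing at the origin. Expanding
`1 / v` about `σ²` with an exact remainder splits the error into the second-order Taylor polynomial
`mmTaylor` and a remainder whose terms are cubic in the small quantities `w, q`, up to a factor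
`v⁻¹`.

The means `w` and `q` are of order `n^(-1/2)` in every `L^p`, by independence and finiteness of all
moments. The crux is that `v⁻¹` is bounded in every `L^p` for large `n`: by AM-GM, `v` dominates the
geometric mean of the squared differences over disjoint pairs of observations, and a bounded density
makes `|X_i - X_j|^(-1/2)` integrable. The geometric mean spreads the singularity over about `n / 2`
independent factors, so each carries only a small exponent. Hence the remainder is `O(n^(-3/2))` in
every `L^p`.

The bias then follows by integrating `mmTaylor` exactly, which needs moments up to order four. For
normality only the linear part of `mmTaylor` survives multiplication by `√n`; the central limit
theorem and Slutsky's lemma conclude. The moments come from a recursion obtained by integrating by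
parts against the density, started with total mass one and mean `μ`. -/

/-! ### Density bounds and moments of the inverse Gaussian law. -/

theorem igPDF_of_pos {μ lam x : ℝ} (hμ : 0 < μ) (hx : 0 < x) :
    igPDF μ lam x = Real.sqrt (lam / (2 * Real.pi)) * Real.exp (lam / μ) * x ^ (-(3 / 2 : ℝ)) *
      Real.exp (-(lam / (2 * μ ^ 2)) * x - lam / 2 * x⁻¹) := by
  rw [igPDF, if_pos hx]
  congr 2
  field_simp
  ring

theorem igPDF_of_nonpos {μ lam x : ℝ} (hx : x ≤ 0) : igPDF μ lam x = 0 := by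
  rw [igPDF, if_neg hx.not_gt]

theorem igPDF_nonneg (μ lam x : ℝ) : 0 ≤ igPDF μ lam x := by
  unfold igPDF
  split_ifs with h
  · positivity
  · exact le_rfl

theorem measurable_igPDF (μ lam : ℝ) : Measurable (igPDF μ lam) := by
  unfold igPDF
  exact Measurable.ite measurableSet_Ioi (by fun_prop) measurable_const

/-- The factor `exp (-a / x)` tames the singularity at zero: the power is at most `1 + t³` with `t =
1 / x`, and the cubic term of the exponential series gives `t³ ≤ 6 / a³ * exp (a * t)`. -/
theorem rpow_neg_mul_exp_neg_inv_le {a x : ℝ} (ha : 0 < a) (hx : 0 < x) :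
    x ^ (-(3 / 2 : ℝ)) * Real.exp (-(a * x⁻¹)) ≤ 1 + 6 / a ^ 3 := by
  have ht : 0 < x⁻¹ := inv_pos.2 hx
  have h1 : x ^ (-(3 / 2 : ℝ)) ≤ 1 + x⁻¹ ^ 3 := by
    rw [Real.rpow_neg hx.le, ← Real.inv_rpow hx.le]
    rcases le_total x⁻¹ 1 with h | h
    · have := Real.rpow_le_one ht.le h (by norm_num : (0 : ℝ) ≤ 3 / 2)
      have : 0 ≤ x⁻¹ ^ 3 := by positivity
      linarith
    · have := Real.rpow_le_rpow_of_exponent_le h (by norm_num : (3 / 2 : ℝ) ≤ (3 : ℕ))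
      rw [Real.rpow_natCast] at this
      linarith
  have h2 : x⁻¹ ^ 3 ≤ 6 / a ^ 3 * Real.exp (a * x⁻¹) := by
    have := Real.pow_div_factorial_le_exp (a * x⁻¹) (by positivity) 3
    rw [mul_pow] at this
    norm_num [Nat.factorial] at this
    rw [div_mul_eq_mul_div, le_div_iff₀ (by positivity)]
    simp only [inv_pow] at this ⊢
    linarith
  have h3 : 1 ≤ Real.exp (a * x⁻¹) := Real.one_le_exp (by positivity)
  rw [Real.exp_neg, ← div_eq_mul_inv, div_le_iff₀ (Real.exp_pos _)]
  nlinarith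

theorem exists_igPDF_le {μ lam : ℝ} (hμ : 0 < μ) (hlam : 0 < lam) :
    ∃ C : ℝ, 0 < C ∧ ∀ x, 0 < x →
      igPDF μ lam x ≤ C * Real.exp (-(lam / (2 * μ ^ 2)) * x) := by
  refine ⟨Real.sqrt (lam / (2 * Real.pi)) * Real.exp (lam / μ) * (1 + 6 / (lam / 2) ^ 3),
    by positivity, fun x hx => ?_⟩
  have h := rpow_neg_mul_exp_neg_inv_le (half_pos hlam) hx
  rw [igPDF_of_pos hμ hx, sub_eq_add_neg, Real.exp_add]
  calc _ = Real.sqrt (lam / (2 * Real.pi)) * Real.exp (lam / μ) *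
        (x ^ (-(3 / 2 : ℝ)) * Real.exp (-(lam / 2 * x⁻¹))) *
          Real.exp (-(lam / (2 * μ ^ 2)) * x) := by ring
    _ ≤ _ := by gcongr

theorem exists_igPDF_le_const {μ lam : ℝ} (hμ : 0 < μ) (hlam : 0 < lam) :
    ∃ C : ℝ, 0 < C ∧ ∀ x, igPDF μ lam x ≤ C := by
  obtain ⟨C, hC, h⟩ := exists_igPDF_le hμ hlam
  refine ⟨C, hC, fun x => ?_⟩
  rcases le_or_gt x 0 with hx | hx
  · rw [igPDF_of_nonpos hx]; exact hC.le
  · refine (h x hx).trans (mul_le_of_le_one_right hC.le (Real.exp_le_one_iff.2 ?_))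
    have : 0 ≤ lam / (2 * μ ^ 2) * x := by positivity
    linarith

theorem integrableOn_pow_mul_igPDF {μ lam : ℝ} (hμ : 0 < μ) (hlam : 0 < lam) (k : ℕ) :
    IntegrableOn (fun x => x ^ k * igPDF μ lam x) (Set.Ioi 0) := by
  obtain ⟨C, hC, h⟩ := exists_igPDF_le hμ hlam
  have hb : 0 < lam / (2 * μ ^ 2) := by positivity
  have hint : IntegrableOn (fun x : ℝ => C * (x ^ (k : ℝ) * Real.exp (-(lam / (2 * μ ^ 2)) * x ^ (1 : ℝ))))
      (Set.Ioi 0) :=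
    (integrableOn_rpow_mul_exp_neg_mul_rpow (by linarith [k.cast_nonneg (α := ℝ)]) one_pos
      hb).const_mul C
  refine hint.mono' ((measurable_id.pow_const k).mul
    (measurable_igPDF μ lam)).aestronglyMeasurable ?_
  filter_upwards [ae_restrict_mem measurableSet_Ioi] with x (hx : 0 < x)
  rw [Real.norm_of_nonneg (mul_nonneg (by positivity) (igPDF_nonneg _ _ _)), Real.rpow_natCast,
    Real.rpow_one, mul_left_comm]
  exact mul_le_mul_of_nonneg_left (h x hx) (by positivity)

theorem setIntegral_Ioi_igPDF (μ lam : ℝ) (f : ℝ → ℝ) :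
    ∫ x, f x ∂(igMeasure μ lam) = ∫ x in Set.Ioi 0, f x * igPDF μ lam x := by
  rw [igMeasure, integral_withDensity_eq_integral_toReal_smul
    (measurable_igPDF μ lam).ennreal_ofReal (by simp), ← integral_indicator measurableSet_Ioi]
  refine integral_congr_ae (ae_of_all _ fun x => ?_)
  by_cases hx : 0 < x
  · simp [Set.indicator_of_mem (Set.mem_Ioi.2 hx), ENNReal.toReal_ofReal (igPDF_nonneg _ _ _),
      mul_comm]
  · simp [hx, igPDF_of_nonpos (not_lt.1 hx)]

theorem integrable_pow_igMeasure {μ lam : ℝ} (hμ : 0 < μ) (hlam : 0 < lam) (k : ℕ) :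
    Integrable (fun x : ℝ => x ^ k) (igMeasure μ lam) := by
  rw [igMeasure, integrable_withDensity_iff_integrable_smul'
    (measurable_igPDF μ lam).ennreal_ofReal (by simp)]
  refine ((integrable_indicator_iff measurableSet_Ioi).2
    (integrableOn_pow_mul_igPDF hμ hlam k)).congr (ae_of_all _ fun x => ?_)
  by_cases hx : 0 < x
  · simp [Set.indicator_of_mem (Set.mem_Ioi.2 hx), ENNReal.toReal_ofReal (igPDF_nonneg _ _ _),
      mul_comm]
  · simp [hx, igPDF_of_nonpos (not_lt.1 hx)]

/-- The inversion `x = μ² / y` fixes the exponent of the density and turns `x φ(x) dx` into `μ φ(y)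
dy`, so the mean is `μ` times the total mass. It is carried out as `x ↦ x⁻¹` followed by a scaling.
-/
theorem integral_igMeasure_id {μ lam : ℝ} (hμ : 0 < μ)
    [IsProbabilityMeasure (igMeasure μ lam)] : ∫ x, x ∂(igMeasure μ lam) = μ := by
  have h1 : ∫ x in Set.Ioi 0, igPDF μ lam x = 1 := by
    have := setIntegral_Ioi_igPDF μ lam (fun _ => 1)
    simpa using this.symm
  rw [setIntegral_Ioi_igPDF, ← integral_comp_rpow_Ioi _ (by norm_num : (-1 : ℝ) ≠ 0)]
  have hb : 0 < (μ ^ 2)⁻¹ := by positivity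
  have h2 := integral_comp_mul_left_Ioi' (fun x : ℝ => (|(-1 : ℝ)| * x ^ ((-1 : ℝ) - 1)) •
      (x ^ (-1 : ℝ) * igPDF μ lam (x ^ (-1 : ℝ)))) 0 hb
  rw [mul_zero] at h2
  rw [← h2]
  calc _ = (μ ^ 2)⁻¹ • ∫ x in Set.Ioi 0, μ ^ 3 * igPDF μ lam x := by
        congr 1
        refine setIntegral_congr_fun measurableSet_Ioi fun x (hx : 0 < x) => ?_
        have hy : ((μ ^ 2)⁻¹ * x) ^ (-1 : ℝ) = μ ^ 2 * x⁻¹ := by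
          rw [Real.rpow_neg_one]; field_simp
        have hpos : 0 < μ ^ 2 * x⁻¹ := by positivity
        have e1 : ((μ ^ 2)⁻¹ * x) ^ ((-1 : ℝ) - 1) = (μ ^ 2 * x⁻¹) ^ 2 := by
          rw [← hy, ← Real.rpow_mul_natCast (by positivity)]; norm_num
        have e2 : (μ ^ 2 * x⁻¹) ^ (-(3 / 2 : ℝ)) = (μ ^ 3)⁻¹ * x ^ 3 * x ^ (-(3 / 2 : ℝ)) := by
          rw [Real.mul_rpow (by positivity) (by positivity), ← Real.rpow_natCast μ 2,
            ← Real.rpow_mul hμ.le, Real.inv_rpow hx.le, ← Real.rpow_neg hx.le,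
            ← Real.rpow_natCast x 3, mul_assoc, ← Real.rpow_add hx, ← Real.rpow_natCast μ 3,
            ← Real.rpow_neg hμ.le]
          norm_num
        simp only [smul_eq_mul]
        rw [hy, e1, igPDF_of_pos hμ hx, igPDF_of_pos hμ hpos, e2]
        have e3 : -(lam / (2 * μ ^ 2)) * (μ ^ 2 * x⁻¹) - lam / 2 * (μ ^ 2 * x⁻¹)⁻¹ =
            -(lam / (2 * μ ^ 2)) * x - lam / 2 * x⁻¹ := by
          field_simp; ring
        rw [e3]
        field_simp
        norm_num
    _ = μ := by
        rw [integral_const_mul, h1, smul_eq_mul]; field_simp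

theorem hasDerivAt_igPDF {μ lam x : ℝ} (hμ : 0 < μ) (hx : 0 < x) :
    HasDerivAt (igPDF μ lam) (igPDF μ lam x *
      (-(3 / 2) * x⁻¹ - lam / (2 * μ ^ 2) + lam / 2 * (x ^ 2)⁻¹)) x := by
  have h1 := (Real.hasDerivAt_rpow_const (p := -(3 / 2 : ℝ)) (Or.inl hx.ne')).const_mul
    (Real.sqrt (lam / (2 * Real.pi)) * Real.exp (lam / μ))
  have h2 : HasDerivAt (fun x : ℝ => Real.exp (-(lam / (2 * μ ^ 2)) * x - lam / 2 * x⁻¹))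
      (Real.exp (-(lam / (2 * μ ^ 2)) * x - lam / 2 * x⁻¹) *
        (-(lam / (2 * μ ^ 2)) * 1 - lam / 2 * (-(x ^ 2)⁻¹))) x :=
    (((hasDerivAt_id x).const_mul _).sub ((hasDerivAt_inv hx.ne').const_mul _)).exp
  refine ((h1.mul h2).congr_of_eventuallyEq ?_).congr_deriv ?_
  · filter_upwards [lt_mem_nhds hx] with y hy
    simp only [Pi.mul_apply]
    rw [igPDF_of_pos hμ hy]
  · rw [igPDF_of_pos hμ hx, Real.rpow_sub_one hx.ne']
    field_simp
    ring

/-- Integrate the derivative of `x ^ (k + 2) * φ(x)` over the half-line. The logarithmic derivative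
of `φ` is a Laurent polynomial, so three consecutive moments appear; `k + 1 / 2` is `(k + 2) - 3 /
2`. -/
theorem integral_igMeasure_pow_add_two {μ lam : ℝ} (hμ : 0 < μ) (hlam : 0 < lam) (k : ℕ) :
    lam / (2 * μ ^ 2) * ∫ x, x ^ (k + 2) ∂(igMeasure μ lam) =
      (k + 1 / 2) * (∫ x, x ^ (k + 1) ∂(igMeasure μ lam)) +
        lam / 2 * ∫ x, x ^ k ∂(igMeasure μ lam) := by
  obtain ⟨C, hC, hle⟩ := exists_igPDF_le hμ hlam
  obtain ⟨C', hC', hle'⟩ := exists_igPDF_le_const hμ hlam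
  have hb : 0 < lam / (2 * μ ^ 2) := by positivity
  have I := integrableOn_pow_mul_igPDF hμ hlam
  have key : ∫ x in Set.Ioi 0, ((k + 1 / 2) * (x ^ (k + 1) * igPDF μ lam x) +
      lam / 2 * (x ^ k * igPDF μ lam x) - lam / (2 * μ ^ 2) * (x ^ (k + 2) * igPDF μ lam x)) =
      0 - 0 ^ (k + 2) * igPDF μ lam 0 := by
    refine integral_Ioi_of_hasDerivAt_of_tendsto
      (f := fun x => x ^ (k + 2) * igPDF μ lam x) ?_ (fun x (hx : 0 < x) => ?_) ?_ ?_
    -- The boundary term at zero vanishes because the density is bounded and the power is positive.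
    · have : Tendsto (fun x : ℝ => |x| ^ (k + 2) * C') (𝓝 0) (𝓝 (|0| ^ (k + 2) * C')) := by
        apply Continuous.tendsto; fun_prop
      rw [abs_zero, zero_pow (by omega), zero_mul] at this
      apply ContinuousAt.continuousWithinAt
      rw [ContinuousAt, zero_pow (by omega), zero_mul]
      refine squeeze_zero_norm (fun x => ?_) this
      rw [norm_mul, norm_pow, Real.norm_of_nonneg (igPDF_nonneg _ _ _), Real.norm_eq_abs]
      exact mul_le_mul_of_nonneg_left (hle' x) (by positivity)
    · refine ((hasDerivAt_pow (k + 2) x).mul (hasDerivAt_igPDF hμ hx)).congr_deriv ?_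
      push_cast
      simp only [pow_succ]
      field_simp
      ring
    · exact (((I (k + 1)).const_mul _).add ((I k).const_mul _)).sub ((I (k + 2)).const_mul _)
    · have := (tendsto_rpow_mul_exp_neg_mul_atTop_nhds_zero ((k + 2 : ℕ) : ℝ) _ hb).const_mul C
      rw [mul_zero] at this
      refine squeeze_zero' ?_ ?_ this
      · filter_upwards [eventually_gt_atTop 0] with x hx
        exact mul_nonneg (by positivity) (igPDF_nonneg _ _ _)
      · filter_upwards [eventually_gt_atTop 0] with x hx
        rw [Real.rpow_natCast, mul_left_comm]
        exact mul_le_mul_of_nonneg_left (hle x hx) (by positivity)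
  rw [igPDF_of_nonpos le_rfl, integral_sub, integral_add, integral_const_mul, integral_const_mul,
    integral_const_mul] at key
  · simp only [setIntegral_Ioi_igPDF]
    linarith
  · exact (I (k + 1)).const_mul _
  · exact (I k).const_mul _
  · exact ((I (k + 1)).const_mul _).add ((I k).const_mul _)
  · exact (I (k + 2)).const_mul _

theorem integral_igMeasure_moments {μ lam : ℝ} (hμ : 0 < μ) (hlam : 0 < lam)
    [IsProbabilityMeasure (igMeasure μ lam)] :
    ∫ x, x ^ 2 ∂(igMeasure μ lam) = μ ^ 2 + μ ^ 3 / lam ∧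
    ∫ x, x ^ 3 ∂(igMeasure μ lam) = μ ^ 3 + 3 * μ ^ 4 / lam + 3 * μ ^ 5 / lam ^ 2 ∧
    ∫ x, x ^ 4 ∂(igMeasure μ lam) =
      μ ^ 4 + 6 * μ ^ 5 / lam + 15 * μ ^ 6 / lam ^ 2 + 15 * μ ^ 7 / lam ^ 3 := by
  have h1 := integral_igMeasure_id (lam := lam) hμ
  have r0 := integral_igMeasure_pow_add_two hμ hlam 0
  have r1 := integral_igMeasure_pow_add_two hμ hlam 1
  have r2 := integral_igMeasure_pow_add_two hμ hlam 2
  simp only [zero_add, pow_zero, pow_one, integral_const, probReal_univ, smul_eq_mul, mul_one,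
    Nat.cast_zero, Nat.cast_one, Nat.cast_ofNat, Nat.reduceAdd, h1] at r0 r1 r2
  have e2 : ∫ x, x ^ 2 ∂(igMeasure μ lam) = μ ^ 2 + μ ^ 3 / lam := by
    field_simp at r0 ⊢
    linarith
  rw [e2] at r1 r2
  have e3 : ∫ x, x ^ 3 ∂(igMeasure μ lam) = μ ^ 3 + 3 * μ ^ 4 / lam + 3 * μ ^ 5 / lam ^ 2 := by
    field_simp at r1 ⊢
    linarith
  rw [e3] at r2
  refine ⟨e2, e3, ?_⟩
  field_simp at r2 ⊢
  linarith

/-! ### Calculus of stochastic orders in all `L^p`. -/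

section MomentOrder

variable {Ω : Type*} [MeasurableSpace Ω] {P : Measure Ω}

/-- All even moments of `Z n` exist and are bounded, for `n` large (depending on the moment). -/
def MomentBounded (P : Measure Ω) (Z : ℕ → Ω → ℝ) : Prop :=
  (∀ n, AEMeasurable (Z n) P) ∧ ∀ p : ℕ, ∃ C : ℝ, ∀ᶠ n in atTop,
    Integrable (fun ω => Z n ω ^ (2 * p)) P ∧ ∫ ω, Z n ω ^ (2 * p) ∂P ≤ C

/-- `Z n` is of order `n ^ (-a / 2)` in every `L^p`. -/
def HasMomentOrder (P : Measure Ω) (a : ℕ) (Z : ℕ → Ω → ℝ) : Prop :=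
  MomentBounded P fun n ω => Real.sqrt n ^ a * Z n ω

theorem MomentBounded.mono {Y Z : ℕ → Ω → ℝ} (hZ : MomentBounded P Z)
    (hY : ∀ n, AEMeasurable (Y n) P) (h : ∀ᶠ n in atTop, ∀ᵐ ω ∂P, |Y n ω| ≤ |Z n ω|) :
    MomentBounded P Y := by
  refine ⟨hY, fun p => ?_⟩
  obtain ⟨C, hC⟩ := hZ.2 p
  refine ⟨C, ?_⟩
  filter_upwards [h, hC] with n hn ⟨hi, hb⟩
  have hle : ∀ᵐ ω ∂P, Y n ω ^ (2 * p) ≤ Z n ω ^ (2 * p) := by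
    filter_upwards [hn] with ω hω
    rw [pow_mul, pow_mul]
    exact pow_le_pow_left₀ (sq_nonneg _) (sq_le_sq.2 hω) p
  have hint : Integrable (fun ω => Y n ω ^ (2 * p)) P := by
    refine hi.mono' ((hY n).pow_const _).aestronglyMeasurable ?_
    filter_upwards [hle] with ω hω
    rwa [Real.norm_of_nonneg ((even_two_mul p).pow_nonneg _)]
  exact ⟨hint, (integral_mono_ae hint hi hle).trans hb⟩

theorem MomentBounded.add {Y Z : ℕ → Ω → ℝ} (hY : MomentBounded P Y) (hZ : MomentBounded P Z) :
    MomentBounded P fun n ω => Y n ω + Z n ω := by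
  refine ⟨fun n => (hY.1 n).add (hZ.1 n), fun p => ?_⟩
  obtain ⟨C, hC⟩ := hY.2 p
  obtain ⟨D, hD⟩ := hZ.2 p
  refine ⟨2 ^ (2 * p - 1) * (C + D), ?_⟩
  filter_upwards [hC, hD] with n ⟨hi, hb⟩ ⟨hi', hb'⟩
  have hle : ∀ ω, (Y n ω + Z n ω) ^ (2 * p) ≤
      2 ^ (2 * p - 1) * (Y n ω ^ (2 * p) + Z n ω ^ (2 * p)) :=
    fun ω => (even_two_mul p).add_pow_le
  have hint' := (hi.add hi').const_mul (2 ^ (2 * p - 1))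
  have hint : Integrable (fun ω => (Y n ω + Z n ω) ^ (2 * p)) P := by
    refine hint'.mono' (((hY.1 n).add (hZ.1 n)).pow_const _).aestronglyMeasurable
      (ae_of_all _ fun ω => ?_)
    rw [Real.norm_of_nonneg ((even_two_mul p).pow_nonneg _)]
    exact hle ω
  refine ⟨hint, (integral_mono hint hint' hle).trans ?_⟩
  simp only [Pi.add_apply]
  rw [integral_const_mul, integral_add hi hi']
  gcongr

/-- By `2ab ≤ a² + b²`, moments of a product cost moments of twice the order of the factors; this is
why all orders are controlled at once. -/
theorem MomentBounded.mul {Y Z : ℕ → Ω → ℝ} (hY : MomentBounded P Y) (hZ : MomentBounded P Z) :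
    MomentBounded P fun n ω => Y n ω * Z n ω := by
  refine ⟨fun n => (hY.1 n).mul (hZ.1 n), fun p => ?_⟩
  obtain ⟨C, hC⟩ := hY.2 (2 * p)
  obtain ⟨D, hD⟩ := hZ.2 (2 * p)
  refine ⟨C + D, ?_⟩
  filter_upwards [hC, hD] with n ⟨hi, hb⟩ ⟨hi', hb'⟩
  have hle : ∀ ω, (Y n ω * Z n ω) ^ (2 * p) ≤ Y n ω ^ (2 * (2 * p)) + Z n ω ^ (2 * (2 * p)) := by
    intro ω
    rw [mul_pow, mul_comm 2 (2 * p), pow_mul (Y n ω) (2 * p) 2, pow_mul (Z n ω) (2 * p) 2]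
    nlinarith [sq_nonneg (Y n ω ^ (2 * p) - Z n ω ^ (2 * p)),
      sq_nonneg (Y n ω ^ (2 * p)), sq_nonneg (Z n ω ^ (2 * p))]
  have hint' := hi.add hi'
  have hint : Integrable (fun ω => (Y n ω * Z n ω) ^ (2 * p)) P := by
    refine hint'.mono' (((hY.1 n).mul (hZ.1 n)).pow_const _).aestronglyMeasurable
      (ae_of_all _ fun ω => ?_)
    rw [Real.norm_of_nonneg ((even_two_mul p).pow_nonneg _)]
    exact hle ω
  refine ⟨hint, (integral_mono hint hint' hle).trans ?_⟩
  simp only [Pi.add_apply]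
  rw [integral_add hi hi']
  gcongr

theorem momentBounded_const [IsProbabilityMeasure P] (c : ℝ) :
    MomentBounded P fun _ _ => c :=
  ⟨fun _ => aemeasurable_const, fun p => ⟨c ^ (2 * p), Eventually.of_forall fun _ =>
    ⟨integrable_const _, by simp⟩⟩⟩

theorem MomentBounded.hasMomentOrder {Z : ℕ → Ω → ℝ} (h : MomentBounded P Z) :
    HasMomentOrder P 0 Z := by
  simpa [HasMomentOrder] using h

theorem HasMomentOrder.mono {a b : ℕ} {Z : ℕ → Ω → ℝ} (h : HasMomentOrder P b Z) (hab : a ≤ b)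
    (hZ : ∀ n, AEMeasurable (Z n) P) : HasMomentOrder P a Z := by
  refine MomentBounded.mono h (fun n => (hZ n).const_mul _) ?_
  filter_upwards [eventually_ge_atTop 1] with n hn
  refine ae_of_all _ fun ω => ?_
  rw [abs_mul, abs_mul, abs_pow, abs_pow, abs_of_nonneg (Real.sqrt_nonneg _)]
  have : 1 ≤ Real.sqrt n := Real.one_le_sqrt.2 (by exact_mod_cast hn)
  gcongr

theorem HasMomentOrder.add {a : ℕ} {Y Z : ℕ → Ω → ℝ} (hY : HasMomentOrder P a Y)
    (hZ : HasMomentOrder P a Z) : HasMomentOrder P a fun n ω => Y n ω + Z n ω := by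
  simpa only [HasMomentOrder, mul_add] using MomentBounded.add hY hZ

theorem HasMomentOrder.mul {a b : ℕ} {Y Z : ℕ → Ω → ℝ} (hY : HasMomentOrder P a Y)
    (hZ : HasMomentOrder P b Z) : HasMomentOrder P (a + b) fun n ω => Y n ω * Z n ω := by
  simpa only [HasMomentOrder, pow_add, mul_mul_mul_comm] using MomentBounded.mul hY hZ

theorem HasMomentOrder.const_mul [IsProbabilityMeasure P] {a : ℕ} {Z : ℕ → Ω → ℝ}
    (hZ : HasMomentOrder P a Z) (c : ℝ) : HasMomentOrder P a fun n ω => c * Z n ω := by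
  simpa using (momentBounded_const c).hasMomentOrder.mul hZ

theorem HasMomentOrder.sub [IsProbabilityMeasure P] {a : ℕ} {Y Z : ℕ → Ω → ℝ}
    (hY : HasMomentOrder P a Y)
    (hZ : HasMomentOrder P a Z) : HasMomentOrder P a fun n ω => Y n ω - Z n ω := by
  simpa [sub_eq_add_neg] using hY.add (hZ.const_mul (-1))

theorem HasMomentOrder.integrable_and_integral_le [IsProbabilityMeasure P] {a : ℕ}
    {Z : ℕ → Ω → ℝ} (hZ : HasMomentOrder P a Z) :
    (∀ᶠ n : ℕ in atTop, Integrable (Z n) P) ∧ ∃ C : ℝ, ∀ᶠ n : ℕ in atTop,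
      Real.sqrt n ^ a * |∫ ω, Z n ω ∂P| ≤ C := by
  obtain ⟨C, hC⟩ := hZ.2 1
  have hint : ∀ᶠ n : ℕ in atTop, Integrable (fun ω => Real.sqrt n ^ a * Z n ω) P := by
    filter_upwards [hC] with n ⟨hi, _⟩
    exact ((memLp_two_iff_integrable_sq (hZ.1 n).aestronglyMeasurable).2 hi).integrable
      one_le_two
  constructor
  · filter_upwards [hint, eventually_ge_atTop 1] with n hi hn
    have h0 : Real.sqrt n ^ a ≠ 0 :=
      (pow_pos (Real.sqrt_pos.2 (by exact_mod_cast hn)) _).ne'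
    simpa [h0] using hi.const_mul (Real.sqrt n ^ a)⁻¹
  · refine ⟨1 + C, ?_⟩
    filter_upwards [hC, hint] with n ⟨hi, hb⟩ hi1
    calc Real.sqrt n ^ a * |∫ ω, Z n ω ∂P| = |∫ ω, Real.sqrt n ^ a * Z n ω ∂P| := by
          rw [integral_const_mul, abs_mul, abs_pow, abs_of_nonneg (Real.sqrt_nonneg _)]
      _ ≤ ∫ ω, |Real.sqrt n ^ a * Z n ω| ∂P := abs_integral_le_integral_abs
      _ ≤ ∫ ω, (1 + (Real.sqrt n ^ a * Z n ω) ^ (2 * 1)) ∂P := by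
          refine integral_mono hi1.abs ((integrable_const _).add hi) fun ω => ?_
          simp only [mul_one]
          rw [← sq_abs (Real.sqrt n ^ a * Z n ω)]
          nlinarith [sq_nonneg (|Real.sqrt n ^ a * Z n ω| - 1)]
      _ ≤ 1 + C := by
          rw [integral_add (integrable_const _) hi]
          simpa using hb

/-- Chebyshev's inequality with the second moment, which is `O(1 / n)`. -/
theorem HasMomentOrder.tendstoInMeasure [IsProbabilityMeasure P] {Z : ℕ → Ω → ℝ}
    (hZ : HasMomentOrder P 1 Z) : TendstoInMeasure P Z atTop 0 := by
  have hm : ∀ n : ℕ, AEMeasurable (fun ω => Real.sqrt n * Z n ω) P := by simpa using hZ.1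
  obtain ⟨C, hC⟩ := hZ.2 1
  intro ε hε
  rcases eq_or_ne ε ∞ with rfl | hε'
  · simp
  lift ε to ℝ≥0 using hε'
  have hε0 : (0 : ℝ) < ε := by exact_mod_cast hε
  have hlim : Tendsto (fun n : ℕ => ENNReal.ofReal (C / ε ^ 2 / n)) atTop (𝓝 0) := by
    rw [← ENNReal.ofReal_zero]
    exact (ENNReal.continuous_ofReal.tendsto 0).comp
      (tendsto_const_nhds.div_atTop tendsto_natCast_atTop_atTop)
  refine tendsto_of_tendsto_of_tendsto_of_le_of_le' tendsto_const_nhds hlim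
    (Eventually.of_forall fun _ => zero_le) ?_
  filter_upwards [hC, eventually_ge_atTop 1] with n ⟨hi, hb⟩ hn
  have hn0 : (0 : ℝ) < n := by exact_mod_cast hn
  simp only [mul_one, pow_one] at hi hb
  have hsub : {x | (ε : ℝ≥0∞) ≤ edist (Z n x) ((0 : Ω → ℝ) x)} ⊆
      {x | (n : ℝ) * ε ^ 2 ≤ (Real.sqrt n * Z n x) ^ 2} := by
    intro x hx
    simp only [Set.mem_ofPred_eq, Pi.zero_apply, edist_zero_right] at hx ⊢
    rw [mul_pow, Real.sq_sqrt hn0.le]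
    have : (ε : ℝ) ≤ |Z n x| := by
      have h' : ε ≤ ‖Z n x‖₊ := by exact_mod_cast hx
      exact_mod_cast h'
    rw [← sq_abs (Z n x)]
    gcongr
  have hmk := mul_meas_ge_le_integral_of_nonneg (ae_of_all P fun ω => sq_nonneg _) hi
    ((n : ℝ) * ε ^ 2)
  calc P _ ≤ P {x | (n : ℝ) * ε ^ 2 ≤ (Real.sqrt n * Z n x) ^ 2} := measure_mono hsub
    _ = ENNReal.ofReal (P.real {x | (n : ℝ) * ε ^ 2 ≤ (Real.sqrt n * Z n x) ^ 2}) := by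
        rw [ofReal_measureReal]
    _ ≤ _ := by
        apply ENNReal.ofReal_le_ofReal
        rw [div_div, le_div_iff₀ (by positivity)]
        linarith

end MomentOrder

/-! ### Even moments of sums of independent centred variables. -/

section SumMoments

variable {Ω : Type*} [MeasurableSpace Ω] {P : Measure Ω}

/-- In the binomial expansion, every term of degree at least two in `x` is bounded by comparing
`|s|` with `|x|`. The linear term is kept exact, since centring will make its expectation vanish. -/
theorem exists_add_pow_even_le (p : ℕ) : ∃ C : ℝ, 0 ≤ C ∧ ∀ s x : ℝ,
    (s + x) ^ (2 * (p + 1)) ≤ s ^ (2 * (p + 1)) + (2 * (p + 1) : ℕ) * s ^ (2 * p + 1) * x +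
      C * (s ^ (2 * p) * x ^ 2 + x ^ (2 * (p + 1))) := by
  refine ⟨∑ j ∈ Finset.range (2 * p + 1), ((2 * (p + 1)).choose (j + 2) : ℝ), by positivity,
    fun s x => ?_⟩
  rw [add_comm s x, add_pow, show 2 * (p + 1) + 1 = 2 * p + 1 + 1 + 1 by ring,
    Finset.sum_range_succ', Finset.sum_range_succ']
  have hterm : ∀ j ∈ Finset.range (2 * p + 1),
      x ^ (j + 1 + 1) * s ^ (2 * (p + 1) - (j + 1 + 1)) * ((2 * (p + 1)).choose (j + 1 + 1) : ℝ) ≤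
        ((2 * (p + 1)).choose (j + 2) : ℝ) * (s ^ (2 * p) * x ^ 2 + x ^ (2 * (p + 1))) := by
    intro j hj
    have hj' : j ≤ 2 * p := by have := Finset.mem_range.1 hj; omega
    rw [mul_comm]
    refine mul_le_mul_of_nonneg_left ?_ (by positivity)
    have e1 : s ^ (2 * p) * x ^ 2 = |s| ^ (2 * p - j) * |s| ^ j * |x| ^ 2 := by
      rw [← pow_add, Nat.sub_add_cancel hj', sq_abs, (even_two_mul p).pow_abs]
    have e2 : x ^ (2 * (p + 1)) = |x| ^ (2 * p - j) * |x| ^ j * |x| ^ 2 := by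
      rw [← pow_add, Nat.sub_add_cancel hj', ← pow_add, ← (even_two_mul (p + 1)).pow_abs]; rfl
    have e3 : x ^ (j + 1 + 1) * s ^ (2 * (p + 1) - (j + 1 + 1)) ≤
        |s| ^ (2 * p - j) * |x| ^ j * |x| ^ 2 := by
      refine (le_abs_self _).trans (le_of_eq ?_)
      rw [abs_mul, abs_pow, abs_pow, show 2 * (p + 1) - (j + 1 + 1) = 2 * p - j by omega,
        pow_succ, pow_succ]
      ring
    refine e3.trans ?_
    rw [e1, e2]
    rcases le_total |s| |x| with h | h
    · have : |s| ^ (2 * p - j) * |x| ^ j * |x| ^ 2 ≤ |x| ^ (2 * p - j) * |x| ^ j * |x| ^ 2 := by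
        gcongr
      have : 0 ≤ |s| ^ (2 * p - j) * |s| ^ j * |x| ^ 2 := by positivity
      linarith
    · have : |s| ^ (2 * p - j) * |x| ^ j * |x| ^ 2 ≤ |s| ^ (2 * p - j) * |s| ^ j * |x| ^ 2 := by
        gcongr
      have : 0 ≤ |x| ^ (2 * p - j) * |x| ^ j * |x| ^ 2 := by positivity
      linarith
  have hs := Finset.sum_le_sum hterm
  rw [← Finset.sum_mul] at hs
  simp only [zero_add, pow_zero, one_mul, Nat.choose_zero_right, Nat.cast_one, mul_one, pow_one,
    Nat.choose_one_right, Nat.sub_zero]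
  rw [show 2 * (p + 1) - 1 = 2 * p + 1 by omega]
  linarith

variable [IsProbabilityMeasure P] {ξ : ℕ → Ω → ℝ}

theorem memLp_of_integrable_pow {Z : Ω → ℝ} (hZ : AEMeasurable Z P)
    (h : ∀ p : ℕ, Integrable (fun ω => Z ω ^ (2 * p)) P) (k : ℕ) : MemLp Z k P := by
  rcases Nat.eq_zero_or_pos k with rfl | hk
  · simpa using hZ.aestronglyMeasurable
  have h2 : MemLp Z (2 * k : ℕ) P := by
    rw [← integrable_norm_rpow_iff hZ.aestronglyMeasurable (by simpa using hk.ne') (ENNReal.natCast_ne_top _)]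
    simpa only [ENNReal.toReal_natCast, Real.rpow_natCast, Real.norm_eq_abs,
      (even_two_mul k).pow_abs] using h k
  exact h2.mono_exponent (by exact_mod_cast (by omega))

theorem integrable_pow_sum (hm : ∀ i, AEMeasurable (ξ i) P)
    (hint : ∀ i p, Integrable (fun ω => ξ i ω ^ (2 * p)) P) (n k : ℕ) :
    Integrable (fun ω => (∑ i ∈ Finset.range n, ξ i ω) ^ k) P := by
  have h : MemLp (fun ω => ∑ i ∈ Finset.range n, ξ i ω) k P :=
    memLp_finsetSum _ fun i _ => memLp_of_integrable_pow (hm i) (hint i) k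
  rcases Nat.eq_zero_or_pos k with rfl | hk
  · simp
  · have := h.integrable_norm_pow (by omega)
    refine this.mono' (h.aestronglyMeasurable.pow _) (ae_of_all _ fun ω => ?_)
    rw [norm_pow]

/-- Induction on `p`: adding one independent centred summand raises the moment of order `2 (p + 1)`
by at most a constant times the `2p`-th moment plus a constant, hence by `O(N ^ p)`; there are `N`
such increments. -/
theorem exists_integral_sum_pow_le (hind : iIndepFun ξ P) (hm : ∀ i, AEMeasurable (ξ i) P)
    (hint : ∀ i p, Integrable (fun ω => ξ i ω ^ (2 * p)) P) (h0 : ∀ i, ∫ ω, ξ i ω ∂P = 0)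
    (M : ℕ → ℝ) (hM : ∀ i p, ∫ ω, ξ i ω ^ (2 * p) ∂P ≤ M p) (p : ℕ) :
    ∃ C : ℝ, ∀ n : ℕ, ∫ ω, (∑ i ∈ Finset.range n, ξ i ω) ^ (2 * p) ∂P ≤ C * (n : ℝ) ^ p := by
  have hS := integrable_pow_sum hm hint
  have hξ : ∀ i k, Integrable (fun ω => ξ i ω ^ k) P := fun i k => by
    have := integrable_pow_sum (ξ := fun _ => ξ i) (fun _ => hm i) (fun _ => hint i) 1 k
    simpa using this
  have hM0 : ∀ q, 0 ≤ M q := fun q =>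
    (integral_nonneg fun ω => (even_two_mul q).pow_nonneg _).trans (hM 0 q)
  induction p with
  | zero => exact ⟨1, fun n => by simp⟩
  | succ p ih =>
    obtain ⟨D, hD⟩ := ih
    obtain ⟨K, hK0, hK⟩ := exists_add_pow_even_le p
    have hD0 : 0 ≤ D := by
      have := (integral_nonneg fun ω => (even_two_mul p).pow_nonneg _).trans (hD 1)
      simpa using this
    refine ⟨K * (D * M 1 + M (p + 1)), fun N => ?_⟩
    have hindep : ∀ n k l, ∫ ω, (∑ i ∈ Finset.range n, ξ i ω) ^ k * ξ n ω ^ l ∂P =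
        (∫ ω, (∑ i ∈ Finset.range n, ξ i ω) ^ k ∂P) * ∫ ω, ξ n ω ^ l ∂P := by
      intro n k l
      have hi := hind.indepFun_sum_range_succ₀ hm n
      have hSm : AEMeasurable (∑ i ∈ Finset.range n, ξ i) P :=
        Finset.aemeasurable_sum _ fun i _ => hm i
      have := hi.integral_fun_comp_mul_comp (f := fun x : ℝ => x ^ k) (g := fun x : ℝ => x ^ l)
        hSm (hm n) (by fun_prop) (by fun_prop)
      simpa using this
    have hindep' : ∀ n k l, Integrable
        (fun ω => (∑ i ∈ Finset.range n, ξ i ω) ^ k * ξ n ω ^ l) P := by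
      intro n k l
      have hi := hind.indepFun_sum_range_succ₀ hm n
      have := (hi.comp (φ := fun x : ℝ => x ^ k) (ψ := fun x : ℝ => x ^ l) (by fun_prop)
        (by fun_prop)).integrable_mul (by simpa [Function.comp_def] using hS n k)
          (by simpa [Function.comp_def] using hξ n l)
      refine this.congr (ae_of_all _ fun ω => by simp)
    -- The increment is bounded through the final index `N` rather than `n`, so that summing the
    -- increments is a mere multiplication.
    have hstep : ∀ n, n < N → ∫ ω, (∑ i ∈ Finset.range (n + 1), ξ i ω) ^ (2 * (p + 1)) ∂P ≤
        ∫ ω, (∑ i ∈ Finset.range n, ξ i ω) ^ (2 * (p + 1)) ∂P +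
          K * (D * M 1 + M (p + 1)) * (N : ℝ) ^ p := by
      intro n hn
      have hN1 : (1 : ℝ) ≤ (N : ℝ) ^ p := one_le_pow₀ (by exact_mod_cast (by omega))
      have i1 := hS n (2 * (p + 1))
      have i2 : Integrable (fun ω => (2 * (p + 1) : ℕ) *
          (∑ i ∈ Finset.range n, ξ i ω) ^ (2 * p + 1) * ξ n ω) P := by
        simpa [mul_assoc] using (hindep' n (2 * p + 1) 1).const_mul ((2 * (p + 1) : ℕ) : ℝ)
      have i3 := hindep' n (2 * p) 2
      have i4 := hξ n (2 * (p + 1))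
      calc _ ≤ ∫ ω, ((∑ i ∈ Finset.range n, ξ i ω) ^ (2 * (p + 1)) + (2 * (p + 1) : ℕ) *
              (∑ i ∈ Finset.range n, ξ i ω) ^ (2 * p + 1) * ξ n ω +
              K * ((∑ i ∈ Finset.range n, ξ i ω) ^ (2 * p) * ξ n ω ^ 2 +
                ξ n ω ^ (2 * (p + 1)))) ∂P := by
            refine integral_mono (hS _ _) ((i1.add i2).add ((i3.add i4).const_mul _)) fun ω => ?_
            simp only [Finset.sum_range_succ]
            exact hK _ _
        _ = ∫ ω, (∑ i ∈ Finset.range n, ξ i ω) ^ (2 * (p + 1)) ∂P +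
              K * ((∫ ω, (∑ i ∈ Finset.range n, ξ i ω) ^ (2 * p) ∂P) * (∫ ω, ξ n ω ^ 2 ∂P) +
                ∫ ω, ξ n ω ^ (2 * (p + 1)) ∂P) := by
            rw [integral_add (by exact i1.add i2) (by exact (i3.add i4).const_mul _),
              integral_add i1 i2, integral_const_mul, integral_add i3 i4, hindep]
            have := hindep n (2 * p + 1) 1
            simp only [pow_one, h0, mul_zero] at this
            simp only [mul_assoc]
            rw [integral_const_mul, this, mul_zero, add_zero]
        _ ≤ _ := by
            have a1 : ∫ ω, (∑ i ∈ Finset.range n, ξ i ω) ^ (2 * p) ∂P ≤ D * (N : ℝ) ^ p :=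
              (hD n).trans (by gcongr)
            have a2 : ∫ ω, ξ n ω ^ 2 ∂P ≤ M 1 := hM n 1
            have a3 : 0 ≤ ∫ ω, ξ n ω ^ 2 ∂P := integral_nonneg fun _ => sq_nonneg _
            have a4 := hM n (p + 1)
            have a5 : (∫ ω, (∑ i ∈ Finset.range n, ξ i ω) ^ (2 * p) ∂P) * (∫ ω, ξ n ω ^ 2 ∂P) ≤
                (D * (N : ℝ) ^ p) * M 1 := by
              gcongr
            have a6 : M (p + 1) ≤ M (p + 1) * (N : ℝ) ^ p :=
              le_mul_of_one_le_right (hM0 _) hN1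
            rw [mul_assoc]
            gcongr
            nlinarith
    have hall : ∀ n, n ≤ N → ∫ ω, (∑ i ∈ Finset.range n, ξ i ω) ^ (2 * (p + 1)) ∂P ≤
        n * (K * (D * M 1 + M (p + 1)) * (N : ℝ) ^ p) := by
      intro n
      induction n with
      | zero => intro _; simp
      | succ n ihn =>
        intro hn
        have := hstep n (by omega)
        have := ihn (by omega)
        push_cast
        linarith
    refine (hall N le_rfl).trans (le_of_eq ?_)
    ring

theorem hasMomentOrder_mean (hind : iIndepFun ξ P) (hm : ∀ i, AEMeasurable (ξ i) P)
    (hint : ∀ i p, Integrable (fun ω => ξ i ω ^ (2 * p)) P) (h0 : ∀ i, ∫ ω, ξ i ω ∂P = 0)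
    (M : ℕ → ℝ) (hM : ∀ i p, ∫ ω, ξ i ω ^ (2 * p) ∂P ≤ M p) :
    HasMomentOrder P 1 fun n ω => (∑ i ∈ Finset.range n, ξ i ω) / n := by
  refine ⟨fun n => ((Finset.aemeasurable_fun_sum _ fun i _ => hm i).div_const _).const_mul _,
    fun p => ?_⟩
  obtain ⟨C, hC⟩ := exists_integral_sum_pow_le hind hm hint h0 M hM p
  refine ⟨C, ?_⟩
  filter_upwards [eventually_ge_atTop 1] with n hn
  have hn0 : (0 : ℝ) < n := by exact_mod_cast hn
  have he : ∀ ω, (Real.sqrt n ^ 1 * ((∑ i ∈ Finset.range n, ξ i ω) / n)) ^ (2 * p) =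
      ((n : ℝ) ^ p)⁻¹ * (∑ i ∈ Finset.range n, ξ i ω) ^ (2 * p) := by
    intro ω
    rw [pow_one, mul_pow, div_pow, pow_mul (Real.sqrt n), Real.sq_sqrt hn0.le, two_mul p, pow_add]
    field_simp
    ring
  simp only [he]
  refine ⟨(integrable_pow_sum hm hint n _).const_mul _, ?_⟩
  rw [integral_const_mul, inv_mul_le_iff₀ (by positivity), mul_comm _ C]
  exact hC n

end SumMoments

/-! ### Inverse moments of the empirical variance. -/

theorem exists_igMeasure_le {μ lam : ℝ} (hμ : 0 < μ) (hlam : 0 < lam) :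
    ∃ C : ℝ≥0, igMeasure μ lam ≤ C • (volume : Measure ℝ) := by
  obtain ⟨C, hC, h⟩ := exists_igPDF_le_const hμ hlam
  refine ⟨C.toNNReal, ?_⟩
  have : C.toNNReal • (volume : Measure ℝ) =
      volume.withDensity fun _ => (C.toNNReal : ℝ≥0∞) := by
    rw [withDensity_const]; rfl
  rw [this, igMeasure]
  exact withDensity_mono (ae_of_all _ fun x => ENNReal.ofReal_le_ofReal (h x))

theorem aemeasurable_empiricalVariance {Ω : Type*} [MeasurableSpace Ω] {P : Measure Ω}
    {X : ℕ → Ω → ℝ} (hm : ∀ i, AEMeasurable (X i) P) (n : ℕ) :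
    AEMeasurable (fun ω => empiricalVariance n fun i => X i ω) P := by
  simp only [empiricalVariance, sampleMean, id]
  have h : AEMeasurable (fun ω => (∑ i ∈ Finset.range n, X i ω) / n) P :=
    (Finset.aemeasurable_fun_sum _ fun i _ => hm i).div_const _
  exact (Finset.aemeasurable_fun_sum _ fun i _ => ((hm i).sub h).pow_const 2).div_const _

section InverseMoments

variable {ν : Measure ℝ} {C : ℝ≥0}

/-- Near `y` the singularity is integrable and Lebesgue measure is translation invariant, so the
bound is uniform in `y`; away from `y` the integrand is at most one. -/
theorem exists_lintegral_abs_sub_rpow_le [IsProbabilityMeasure ν]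
    (hν : ν ≤ C • (volume : Measure ℝ)) :
    ∃ K : ℝ≥0, ∀ y, ∫⁻ x, ENNReal.ofReal (|x - y| ^ (-(1 / 2) : ℝ)) ∂ν ≤ K := by
  set f : ℝ → ℝ := (Set.Ioc (0 : ℝ) 1).indicator fun u => u ^ (-(1 / 2) : ℝ) with hf
  have hfm : Measurable f := Measurable.indicator (by fun_prop) measurableSet_Ioc
  have hint : Integrable (fun u => f |u|) := by
    have hi : Integrable f := (integrable_indicator_iff measurableSet_Ioc).2 <|
      (intervalIntegrable_iff_integrableOn_Ioc_of_le zero_le_one).1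
        (intervalIntegral.intervalIntegrable_rpow' (by norm_num))
    refine (hi.add hi.comp_neg).congr (ae_of_all _ fun u => ?_)
    have h0 : ∀ v ≤ 0, f v = 0 := fun v hv =>
      Set.indicator_of_notMem (fun h => hv.not_gt h.1) _
    rcases le_total u 0 with hu | hu
    · simp [abs_of_nonpos hu, h0 u hu]
    · simp [abs_of_nonneg hu, h0 (-u) (by linarith)]
  have hL : ∫⁻ u, ENNReal.ofReal (f |u|) ≠ ∞ := hint.lintegral_lt_top.ne
  refine ⟨1 + C * (∫⁻ u, ENNReal.ofReal (f |u|)).toNNReal, fun y => ?_⟩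
  calc ∫⁻ x, ENNReal.ofReal (|x - y| ^ (-(1 / 2) : ℝ)) ∂ν
      ≤ ∫⁻ x, (1 + ENNReal.ofReal (f |x - y|)) ∂ν := by
        refine lintegral_mono fun x => ?_
        by_cases hx : |x - y| ∈ Set.Ioc (0 : ℝ) 1
        · rw [hf, Set.indicator_of_mem hx]
          exact le_add_self
        · refine le_add_right (ENNReal.ofReal_le_one.2 ?_)
          rcases (abs_nonneg (x - y)).eq_or_lt with h0 | h0
          -- On the diagonal the real power of zero takes the default value `0`, so the bound by one
          -- persists.
          · rw [← h0, Real.zero_rpow (by norm_num)]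
            exact zero_le_one
          · have h1 : 1 ≤ |x - y| := by
              by_contra h
              exact hx ⟨h0, (not_le.1 h).le⟩
            exact Real.rpow_le_one_of_one_le_of_nonpos h1 (by norm_num)
    _ = 1 + ∫⁻ x, ENNReal.ofReal (f |x - y|) ∂ν := by
        rw [lintegral_add_left measurable_const]
        simp
    _ ≤ 1 + ∫⁻ x, ENNReal.ofReal (f |x - y|) ∂(C • (volume : Measure ℝ)) := by
        gcongr
    _ = 1 + C * ∫⁻ u, ENNReal.ofReal (f |u|) := by
        rw [lintegral_smul_measure,
          lintegral_sub_right_eq_self (fun u => ENNReal.ofReal (f |u|)) y]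
        rfl
    _ = _ := by
        push_cast
        rw [ENNReal.coe_toNNReal hL]

variable {Ω : Type*} [MeasurableSpace Ω] {P : Measure Ω} [IsProbabilityMeasure P] {X : ℕ → Ω → ℝ}

theorem map_prodMk_eq_prod (hlaw : ∀ i, HasLaw (X i) ν P) (hindep : iIndepFun X P) {i j : ℕ}
    (hij : i ≠ j) : P.map (fun ω => (X i ω, X j ω)) = ν.prod ν := by
  have := (indepFun_iff_map_prod_eq_prod_map_map (hlaw i).aemeasurable
    (hlaw j).aemeasurable).1 (hindep.indepFun hij)
  rw [this, (hlaw i).map_eq, (hlaw j).map_eq]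

theorem ae_ne_of_hasLaw [IsProbabilityMeasure ν] (hν : ν ≤ C • (volume : Measure ℝ))
    (hlaw : ∀ i, HasLaw (X i) ν P) (hindep : iIndepFun X P) {i j : ℕ} (hij : i ≠ j) :
    ∀ᵐ ω ∂P, X i ω ≠ X j ω := by
  have hm : AEMeasurable (fun ω => (X i ω, X j ω)) P :=
    (hlaw i).aemeasurable.prodMk (hlaw j).aemeasurable
  have hd : MeasurableSet {z : ℝ × ℝ | z.1 = z.2} := measurableSet_eq_fun measurable_fst measurable_snd
  have h : (ν.prod ν) {z : ℝ × ℝ | z.1 = z.2} = 0 := by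
    rw [Measure.measure_prod_null hd]
    refine ae_of_all _ fun x => le_antisymm ((hν _).trans ?_) zero_le
    have : (Prod.mk x ⁻¹' {z : ℝ × ℝ | z.1 = z.2}) = {x} := by
      ext y; simp [eq_comm]
    rw [this]
    simp
  rw [← map_prodMk_eq_prod hlaw hindep hij, Measure.map_apply_of_aemeasurable hm hd] at h
  exact measure_eq_zero_iff_ae_notMem.1 h

theorem lintegral_pair_le [IsProbabilityMeasure ν] {K : ℝ≥0}
    (hK : ∀ y, ∫⁻ x, ENNReal.ofReal (|x - y| ^ (-(1 / 2) : ℝ)) ∂ν ≤ K)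
    (hlaw : ∀ i, HasLaw (X i) ν P) (hindep : iIndepFun X P) {i j : ℕ} (hij : i ≠ j) :
    ∫⁻ ω, ENNReal.ofReal (|X i ω - X j ω| ^ (-(1 / 2) : ℝ)) ∂P ≤ K := by
  have hm : AEMeasurable (fun ω => (X i ω, X j ω)) P :=
    (hlaw i).aemeasurable.prodMk (hlaw j).aemeasurable
  have hg : Measurable fun z : ℝ × ℝ => ENNReal.ofReal (|z.1 - z.2| ^ (-(1 / 2) : ℝ)) := by
    fun_prop
  calc _ = ∫⁻ z, ENNReal.ofReal (|z.1 - z.2| ^ (-(1 / 2) : ℝ)) ∂(ν.prod ν) := by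
        rw [← map_prodMk_eq_prod hlaw hindep hij, lintegral_map' hg.aemeasurable hm]
    _ = ∫⁻ y, ∫⁻ x, ENNReal.ofReal (|x - y| ^ (-(1 / 2) : ℝ)) ∂ν ∂ν :=
        lintegral_prod_symm _ hg.aemeasurable
    _ ≤ ∫⁻ _, (K : ℝ≥0∞) ∂ν := lintegral_mono hK
    _ = K := by simp

/-- Disjoint pairs of independent variables are independent, so the integral factors one pair at a
time. -/
theorem lintegral_prod_pairs (hm : ∀ i, AEMeasurable (X i) P) (hindep : iIndepFun X P)
    {h : ℝ × ℝ → ℝ≥0∞} (hh : Measurable h) (m : ℕ) :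
    ∫⁻ ω, ∏ j ∈ Finset.range m, h (X (2 * j) ω, X (2 * j + 1) ω) ∂P =
      ∏ j ∈ Finset.range m, ∫⁻ ω, h (X (2 * j) ω, X (2 * j + 1) ω) ∂P := by
  have hmeas : ∀ j, AEMeasurable (fun ω => h (X (2 * j) ω, X (2 * j + 1) ω)) P := fun j =>
    hh.comp_aemeasurable ((hm _).prodMk (hm _))
  induction m with
  | zero => simp
  | succ m ih =>
    simp only [Finset.prod_range_succ]
    rw [← ih]
    refine lintegral_mul_eq_lintegral_mul_lintegral_of_indepFun''
      (Finset.aemeasurable_fun_prod _ fun j _ => hmeas j) (hmeas m) ?_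
    have hST : Disjoint (Finset.range (2 * m)) {2 * m, 2 * m + 1} := by
      simp [Finset.disjoint_left]
      omega
    have hi := hindep.indepFun_finset₀ _ _ hST hm
    let φ : (Finset.range (2 * m) → ℝ) → ℝ≥0∞ := fun x =>
      ∏ j : Fin m, h (x ⟨2 * j, Finset.mem_range.2 (by omega)⟩,
        x ⟨2 * j + 1, Finset.mem_range.2 (by omega)⟩)
    let ψ : (({2 * m, 2 * m + 1} : Finset ℕ) → ℝ) → ℝ≥0∞ := fun x =>
      h (x ⟨2 * m, by simp⟩, x ⟨2 * m + 1, by simp⟩)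
    have hφ : Measurable φ := by
      refine Finset.measurable_fun_prod _ fun j _ => hh.comp ?_
      fun_prop
    have hψ : Measurable ψ := by
      refine hh.comp ?_
      fun_prop
    have := hi.comp hφ hψ
    convert this using 1
    swap
    · rfl
    funext ω
    simp only [Function.comp_apply, φ]
    rw [← Fin.prod_univ_eq_prod_range (fun j => h (X (2 * j) ω, X (2 * j + 1) ω))]

theorem sum_range_two_mul (f : ℕ → ℝ) (m : ℕ) :
    ∑ i ∈ Finset.range (2 * m), f i = ∑ j ∈ Finset.range m, (f (2 * j) + f (2 * j + 1)) := by
  induction m with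
  | zero => simp
  | succ m ih =>
    rw [show 2 * (m + 1) = 2 * m + 1 + 1 by ring, Finset.sum_range_succ, Finset.sum_range_succ,
      Finset.sum_range_succ, ih]
    ring

/-- AM-GM bounds the geometric mean by the average of the squared differences, and `(a - b)² ≤ 2 (a
- c)² + 2 (b - c)²` brings in the sample mean `c`. The constant is `6 = 2 * 3`, since `n ≤ 3 * (n /
2)` with integer division for `n ≥ 2`. -/
theorem prod_pairs_le_empiricalVariance {n : ℕ} (hn : 2 ≤ n) (x : ℕ → ℝ) :
    ∏ j ∈ Finset.range (n / 2), ((x (2 * j) - x (2 * j + 1)) ^ 2) ^ ((n / 2 : ℕ) : ℝ)⁻¹ ≤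
      6 * empiricalVariance n x := by
  set m := n / 2 with hm
  have hm0 : (0 : ℝ) < m := by exact_mod_cast (by omega : 0 < m)
  have hn0 : (0 : ℝ) < n := by exact_mod_cast (by omega : 0 < n)
  have hnm : (n : ℝ) ≤ 3 * m := by exact_mod_cast (by omega : n ≤ 3 * m)
  have amgm := Real.geom_mean_le_arith_mean_weighted (Finset.range m) (fun _ => (m : ℝ)⁻¹)
    (fun j => (x (2 * j) - x (2 * j + 1)) ^ 2) (fun _ _ => by positivity)
    (by simp [hm0.ne']) (fun _ _ => sq_nonneg _)
  refine amgm.trans ?_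
  rw [← Finset.mul_sum, empiricalVariance]
  simp only [sampleMean]
  set c := (∑ i ∈ Finset.range n, id (x i)) / n
  have h1 : ∑ j ∈ Finset.range m, (x (2 * j) - x (2 * j + 1)) ^ 2 ≤
      2 * ∑ i ∈ Finset.range n, (x i - c) ^ 2 := by
    calc _ ≤ ∑ j ∈ Finset.range m, 2 * ((x (2 * j) - c) ^ 2 + (x (2 * j + 1) - c) ^ 2) :=
          Finset.sum_le_sum fun j _ => by
            nlinarith [sq_nonneg (x (2 * j) - c + (x (2 * j + 1) - c))]
      _ = 2 * ∑ i ∈ Finset.range (2 * m), (x i - c) ^ 2 := by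
          rw [← Finset.mul_sum, sum_range_two_mul]
      _ ≤ _ := by
          gcongr
          omega
  have h2 : 0 ≤ ∑ i ∈ Finset.range n, (x i - c) ^ 2 := Finset.sum_nonneg fun _ _ => sq_nonneg _
  rw [inv_mul_le_iff₀ hm0]
  refine h1.trans ?_
  rw [show (m : ℝ) * (6 * ((∑ i ∈ Finset.range n, (x i - c) ^ 2) / n)) =
    (6 * m * ∑ i ∈ Finset.range n, (x i - c) ^ 2) / n by ring, le_div_iff₀ hn0]
  nlinarith

theorem inv_empiricalVariance_pow_le {n : ℕ} (hn : 2 ≤ n) (x : ℕ → ℝ)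
    (hx : ∀ j, x (2 * j) ≠ x (2 * j + 1)) (p : ℕ) :
    0 < empiricalVariance n x ∧ (empiricalVariance n x)⁻¹ ^ (2 * p) ≤ 6 ^ (2 * p) *
      ∏ j ∈ Finset.range (n / 2),
        (|x (2 * j) - x (2 * j + 1)| ^ (-(1 / 2) : ℝ)) ^ (8 * p / (n / 2 : ℕ) : ℝ) := by
  have h := prod_pairs_le_empiricalVariance hn x
  set m := n / 2 with hm
  have hΔ : ∀ j, 0 < (x (2 * j) - x (2 * j + 1)) ^ 2 := fun j =>
    sq_pos_of_ne_zero (sub_ne_zero.2 (hx j))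
  set R := ∏ j ∈ Finset.range m, ((x (2 * j) - x (2 * j + 1)) ^ 2) ^ (m : ℝ)⁻¹ with hR
  have hR0 : 0 < R := Finset.prod_pos fun j _ => Real.rpow_pos_of_pos (hΔ j) _
  have hV : 0 < empiricalVariance n x := by linarith
  refine ⟨hV, ?_⟩
  have h1 : (empiricalVariance n x)⁻¹ ≤ 6 * R⁻¹ := by
    rw [← div_eq_mul_inv, le_div_iff₀ hR0, inv_mul_le_iff₀ hV]
    linarith
  refine (pow_le_pow_left₀ (inv_pos.2 hV).le h1 _).trans (le_of_eq ?_)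
  rw [mul_pow, hR, ← Finset.prod_inv_distrib, ← Finset.prod_pow]
  congr 1
  refine Finset.prod_congr rfl fun j _ => ?_
  have ha : 0 < |x (2 * j) - x (2 * j + 1)| := abs_pos.2 (sub_ne_zero.2 (hx j))
  rw [← sq_abs, ← Real.rpow_natCast _ 2, ← Real.rpow_natCast _ (2 * p), ← Real.rpow_mul ha.le,
    ← Real.rpow_neg ha.le, ← Real.rpow_mul ha.le, ← Real.rpow_mul ha.le]
  congr 1
  push_cast
  ring

/-- Jensen's inequality for a concave power, from monotonicity of `L^p` norms on a probability
space. -/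
theorem lintegral_rpow_le_rpow_lintegral {f : Ω → ℝ≥0∞} (hf : AEMeasurable f P) {s : ℝ}
    (hs0 : 0 ≤ s) (hs : s ≤ 1) : ∫⁻ ω, f ω ^ s ∂P ≤ (∫⁻ ω, f ω ∂P) ^ s := by
  rcases hs0.eq_or_lt with rfl | h0
  · simp
  have := eLpNorm'_le_eLpNorm'_of_exponent_le h0 hs P hf.aestronglyMeasurable
  simp only [eLpNorm', enorm_eq_self, ENNReal.rpow_one, one_div, inv_one] at this
  calc _ = ((∫⁻ ω, f ω ^ s ∂P) ^ s⁻¹) ^ s := by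
        rw [← ENNReal.rpow_mul, inv_mul_cancel₀ h0.ne', ENNReal.rpow_one]
    _ ≤ _ := by gcongr

theorem momentBounded_inv_empiricalVariance [IsProbabilityMeasure ν]
    (hν : ν ≤ C • (volume : Measure ℝ))
    (hlaw : ∀ i, HasLaw (X i) ν P) (hindep : iIndepFun X P) :
    MomentBounded P fun n ω => (empiricalVariance n fun i => X i ω)⁻¹ := by
  have hm : ∀ i, AEMeasurable (X i) P := fun i => (hlaw i).aemeasurable
  have hmV := fun n => (aemeasurable_empiricalVariance hm n).inv
  refine ⟨hmV, fun p => ?_⟩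
  obtain ⟨K, hK⟩ := exists_lintegral_abs_sub_rpow_le hν
  refine ⟨6 ^ (2 * p) * (K : ℝ) ^ (8 * p), ?_⟩
  have hne : ∀ᵐ ω ∂P, ∀ j, X (2 * j) ω ≠ X (2 * j + 1) ω :=
    ae_all_iff.2 fun j => ae_ne_of_hasLaw hν hlaw hindep (by omega)
  -- This threshold gives `m = n / 2 ≥ 8 * p`, so that `s = 8 * p / m ≤ 1` and Jensen applies to
  -- each factor. As `s * m = 8 * p`, the resulting bound does not depend on `n`.
  filter_upwards [eventually_ge_atTop (16 * p + 2)] with n hn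
  set m := n / 2 with hmdef
  have hm0 : (0 : ℝ) < m := by exact_mod_cast (by omega : 0 < m)
  set s : ℝ := 8 * p / m with hs
  have hs0 : 0 ≤ s := by positivity
  have hs1 : s ≤ 1 := by
    rw [hs, div_le_one hm0]
    exact_mod_cast (by omega : 8 * p ≤ m)
  have hnn : ∀ ω, 0 ≤ (empiricalVariance n fun i => X i ω)⁻¹ ^ (2 * p) := fun ω =>
    (even_two_mul p).pow_nonneg _
  have hmg : ∀ j, AEMeasurable (fun ω => ENNReal.ofReal
      (|X (2 * j) ω - X (2 * j + 1) ω| ^ (-(1 / 2) : ℝ))) P := fun j =>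
    (((measurable_fst.sub measurable_snd).abs.pow_const _).ennreal_ofReal.comp_aemeasurable
      ((hm (2 * j)).prodMk (hm (2 * j + 1))))
  have hbound : ∫⁻ ω, ENNReal.ofReal ((empiricalVariance n fun i => X i ω)⁻¹ ^ (2 * p)) ∂P ≤
      ENNReal.ofReal (6 ^ (2 * p) * (K : ℝ) ^ (8 * p)) := by
    calc _ ≤ ∫⁻ ω, ENNReal.ofReal (6 ^ (2 * p)) * ∏ j ∈ Finset.range m,
            ENNReal.ofReal (|X (2 * j) ω - X (2 * j + 1) ω| ^ (-(1 / 2) : ℝ)) ^ s ∂P := by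
          refine lintegral_mono_ae ?_
          filter_upwards [hne] with ω hω
          have := (inv_empiricalVariance_pow_le (by omega : 2 ≤ n) (fun i => X i ω) hω p).2
          refine (ENNReal.ofReal_le_ofReal this).trans (le_of_eq ?_)
          rw [ENNReal.ofReal_mul (by positivity), ENNReal.ofReal_prod_of_nonneg
            fun j _ => by positivity]
          congr 1
          refine Finset.prod_congr rfl fun j _ => ?_
          rw [ENNReal.ofReal_rpow_of_nonneg (by positivity) hs0]
      _ = ENNReal.ofReal (6 ^ (2 * p)) * ∏ j ∈ Finset.range m, ∫⁻ ω,
            ENNReal.ofReal (|X (2 * j) ω - X (2 * j + 1) ω| ^ (-(1 / 2) : ℝ)) ^ s ∂P := by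
          rw [lintegral_const_mul' _ _ ENNReal.ofReal_ne_top]
          congr 1
          exact lintegral_prod_pairs hm hindep
            (h := fun z => ENNReal.ofReal (|z.1 - z.2| ^ (-(1 / 2) : ℝ)) ^ s) (by fun_prop) m
      _ ≤ ENNReal.ofReal (6 ^ (2 * p)) * ∏ _j ∈ Finset.range m, (K : ℝ≥0∞) ^ s := by
          gcongr with j hj
          refine (lintegral_rpow_le_rpow_lintegral (hmg j) hs0 hs1).trans ?_
          gcongr
          exact lintegral_pair_le hK hlaw hindep (by omega)
      _ = _ := by
          rw [Finset.prod_const, Finset.card_range, ← ENNReal.rpow_mul_natCast, hs,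
            div_mul_cancel₀ _ hm0.ne', ENNReal.ofReal_mul (by positivity),
            ENNReal.ofReal_pow K.coe_nonneg, ENNReal.ofReal_coe_nnreal,
            ← ENNReal.rpow_natCast]
          push_cast
          rfl
  have hint : Integrable (fun ω => (empiricalVariance n fun i => X i ω)⁻¹ ^ (2 * p)) P :=
    ⟨((hmV n).pow_const _).aestronglyMeasurable, by
      rw [hasFiniteIntegral_iff_ofReal (ae_of_all _ hnn)]
      exact hbound.trans_lt ENNReal.ofReal_lt_top⟩
  refine ⟨hint, ?_⟩
  rw [integral_eq_lintegral_of_nonneg_ae (ae_of_all _ hnn) hint.aestronglyMeasurable]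
  exact ENNReal.toReal_le_of_le_ofReal (by positivity) hbound

end InverseMoments

/-! ### Constant weight and the Taylor expansion of `steinG`. -/

theorem steinEstimator_one (n : ℕ) (x : ℕ → ℝ) :
    steinEstimator (fun _ => 1) n x = mmEstimator n x := by
  rcases Nat.eq_zero_or_pos n with rfl | hn
  · simp [steinEstimator, mmEstimator, sampleMean]
  have hn0 : (n : ℝ) ≠ 0 := by positivity
  have hV : empiricalVariance n x =
      sampleMean (fun t => t ^ 2 * (1 : ℝ)) n x - sampleMean id n x ^ 2 := by
    rw [empiricalVariance]
    set c := sampleMean id n x with hc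
    have hsum : ∑ i ∈ Finset.range n, x i = n * c := by
      rw [hc, sampleMean]; simp only [id]; field_simp
    simp only [sampleMean, sub_sq, Finset.sum_add_distrib, Finset.sum_sub_distrib, ← Finset.sum_mul,
      ← Finset.mul_sum, hsum, Finset.sum_const, Finset.card_range, nsmul_eq_mul, mul_one]
    field_simp
    ring
  have h1 : sampleMean (fun _ => (1 : ℝ)) n x = 1 := by simp [sampleMean, hn0]
  have h2 : sampleMean (fun t => t ^ 2 * deriv (fun _ : ℝ => (1 : ℝ)) t) n x = 0 := by
    simp [sampleMean]
  have h3 : sampleMean (fun t => t * (1 : ℝ)) n x = sampleMean id n x := by simp [sampleMean]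
  rw [steinEstimator, mmEstimator, hV, h1, h2, h3]
  ring

theorem contDiffAt_steinG {z : Fin 5 → ℝ} (hz : z 3 - z 0 ^ 2 * z 1 ≠ 0) :
    ContDiffAt ℝ 2 steinG z := by
  unfold steinG
  exact ContDiffAt.div (by fun_prop) (by fun_prop) hz

/-- Restricting `g` to the line through `a` in direction `v` reduces gradient and Hessian to two
one-variable derivatives at zero. -/
theorem taylorTwo_eq_of_hasDerivAt {g : (Fin 5 → ℝ) → ℝ} {a v : Fin 5 → ℝ}
    (hg : ContDiffAt ℝ 2 g a) {h : ℝ → ℝ} {d : ℝ}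
    (h1 : ∀ᶠ t in 𝓝 (0 : ℝ), HasDerivAt (fun t => g (a + t • v)) (h t) t)
    (h2 : HasDerivAt h d 0) : taylorTwo g a v = h 0 + 1 / 2 * d := by
  have hline : ∀ t : ℝ, HasDerivAt (fun t : ℝ => a + t • v) v t := fun t => by
    simpa using ((hasDerivAt_id t).smul_const v).const_add a
  have hcont : Tendsto (fun t : ℝ => a + t • v) (𝓝 0) (𝓝 a) := by
    have := (hline 0).continuousAt.tendsto
    simpa using this
  have hdiff : ∀ᶠ z in 𝓝 a, DifferentiableAt ℝ g z := by
    filter_upwards [hg.eventually (by simp)] with z hz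
    exact hz.differentiableAt (by simp)
  have heq : ∀ᶠ t in 𝓝 (0 : ℝ), fderiv ℝ g (a + t • v) v = h t := by
    filter_upwards [h1, hcont.eventually hdiff] with t ht hd
    exact (hd.hasFDerivAt.comp_hasDerivAt t (hline t)).unique ht
  have hd2 : DifferentiableAt ℝ (fderiv ℝ g) (a + (0 : ℝ) • v) := by
    rw [zero_smul, add_zero]
    exact (hg.fderiv_right (m := 1) (by norm_num)).differentiableAt (by simp)
  have h3 : HasDerivAt (fun t : ℝ => fderiv ℝ g (a + t • v) v)
      (fderiv ℝ (fderiv ℝ g) (a + (0 : ℝ) • v) v v) 0 := by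
    have h6 : HasDerivAt (fun t : ℝ => fderiv ℝ g (a + t • v))
        (fderiv ℝ (fderiv ℝ g) (a + (0 : ℝ) • v) v) 0 :=
      hd2.hasFDerivAt.comp_hasDerivAt (0 : ℝ) (hline 0)
    simpa using h6.clm_apply (hasDerivAt_const (0 : ℝ) v)
  have h4 := h3.unique (h2.congr_of_eventuallyEq heq)
  have h5 := heq.self_of_nhds
  rw [zero_smul, add_zero] at h4 h5
  rw [taylorTwo, h4, h5]

theorem taylorTwo_steinG {μ s : ℝ} (hs : 0 < s) (w q : ℝ) :
    taylorTwo steinG ![μ, 1, μ, μ ^ 2 + s, 0] ![w, 0, w, q + 2 * μ * w, 0] =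
      (3 * μ ^ 2 * w / s - μ ^ 3 * q / s ^ 2) +
        (3 * μ * w ^ 2 / s + μ ^ 3 * w ^ 2 / s ^ 2 - 3 * μ ^ 2 * w * q / s ^ 2 +
          μ ^ 3 * q ^ 2 / s ^ 3) := by
  -- The denominator of `steinG` along the line: the shift `2 * μ * w` in the increment cancels the
  -- cross term of `(μ + t * w)²`.
  set D : ℝ → ℝ := fun t => s + t * q - t ^ 2 * w ^ 2 with hD
  have hD0 : D 0 = s := by simp [hD]
  have hDd : ∀ t, HasDerivAt D (q - 2 * t * w ^ 2) t := fun t => by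
    have := (((hasDerivAt_id t).mul_const q).const_add s).sub
      ((hasDerivAt_pow 2 t).mul_const (w ^ 2))
    refine this.congr_deriv ?_
    simp
  have hN : ∀ t, HasDerivAt (fun t : ℝ => μ + t * w) w t := fun t => by
    simpa using ((hasDerivAt_id t).mul_const w).const_add μ
  have hDne : ∀ᶠ t in 𝓝 (0 : ℝ), D t ≠ 0 :=
    (hDd 0).continuousAt.eventually_ne (by rw [hD0]; exact hs.ne')
  set h : ℝ → ℝ := fun t =>
    (3 * (μ + t * w) ^ 2 * w * D t - (μ + t * w) ^ 3 * (q - 2 * t * w ^ 2)) / D t ^ 2 with hh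
  have key := taylorTwo_eq_of_hasDerivAt (g := steinG) (a := ![μ, 1, μ, μ ^ 2 + s, 0])
    (v := ![w, 0, w, q + 2 * μ * w, 0]) (h := h)
    (d := ((3 * (2 * μ * w) * w * s + 3 * μ ^ 2 * w * q - (3 * μ ^ 2 * w * q +
      μ ^ 3 * (-(2 * w ^ 2)))) * s ^ 2 - (3 * μ ^ 2 * w * s - μ ^ 3 * q) * (2 * s * q)) / (s ^ 2) ^ 2)
    (contDiffAt_steinG (by simp [hs.ne'])) ?_ ?_
  · rw [key, hh]
    simp only [hD0]
    field_simp
    ring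
  · filter_upwards [hDne] with t ht
    have e : (fun t : ℝ => steinG (![μ, 1, μ, μ ^ 2 + s, 0] + t • ![w, 0, w, q + 2 * μ * w, 0])) =
        fun t => (μ + t * w) ^ 3 / D t := by
      funext t
      simp only [steinG, hD, Pi.add_apply, Pi.smul_apply, smul_eq_mul]
      simp
      congr 1; ring
    rw [e]
    refine (((hN t).pow 3).div (hDd t) ht).congr_deriv ?_
    simp only [hh]
    push_cast
    simp
  · have h1 := ((((((hN 0).pow 2).const_mul 3).mul_const w).mul (hDd 0)).sub
      (((hN 0).pow 3).mul
        (((((hasDerivAt_id (0 : ℝ)).const_mul 2).mul_const (w ^ 2)).const_sub q)))).div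
      ((hDd 0).pow 2) (by simp [hD0, hs.ne'])
    refine (h1.congr_deriv ?_).congr_of_eventuallyEq (Eventually.of_forall fun t => ?_)
    · simp [hD0]
    · simp [hh]

/-! ### Sample means of polynomials in the data. -/

section PolynomialMeans

variable {ν : Measure ℝ} {Ω : Type*} [MeasurableSpace Ω] {P : Measure Ω} {X : ℕ → Ω → ℝ}

theorem integrable_polynomial_eval (hν : ∀ k : ℕ, Integrable (fun x : ℝ => x ^ k) ν)
    (f : Polynomial ℝ) : Integrable (fun x => f.eval x) ν := by
  simp only [Polynomial.eval_eq_sum_range]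
  exact integrable_finsetSum _ fun i _ => (hν i).const_mul _

theorem integrable_eval_comp (hν : ∀ k : ℕ, Integrable (fun x : ℝ => x ^ k) ν)
    (hlaw : ∀ i, HasLaw (X i) ν P) (f : Polynomial ℝ) (i : ℕ) :
    Integrable (fun ω => f.eval (X i ω)) P := by
  have h := integrable_polynomial_eval hν f
  rw [← (hlaw i).map_eq] at h
  exact h.comp_aemeasurable (hlaw i).aemeasurable

theorem integral_eval_comp (hlaw : ∀ i, HasLaw (X i) ν P) (f : Polynomial ℝ) (i : ℕ) :
    ∫ ω, f.eval (X i ω) ∂P = ∫ x, f.eval x ∂ν :=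
  (hlaw i).integral_comp (f := fun x => f.eval x)
    (f.continuous.measurable.aestronglyMeasurable)

theorem aemeasurable_eval_comp (hlaw : ∀ i, HasLaw (X i) ν P) (f : Polynomial ℝ) (i : ℕ) :
    AEMeasurable (fun ω => f.eval (X i ω)) P :=
  f.continuous.measurable.comp_aemeasurable (hlaw i).aemeasurable

theorem integral_sampleMean_eval (hν : ∀ k : ℕ, Integrable (fun x : ℝ => x ^ k) ν)
    (hlaw : ∀ i, HasLaw (X i) ν P) {f : Polynomial ℝ}
    (hf : ∫ x, f.eval x ∂ν = 0) (n : ℕ) :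
    Integrable (fun ω => sampleMean (fun t => f.eval t) n fun i => X i ω) P ∧
      ∫ ω, sampleMean (fun t => f.eval t) n (fun i => X i ω) ∂P = 0 := by
  have hi := integrable_eval_comp hν hlaw f
  constructor
  · exact (integrable_finsetSum _ fun i _ => hi i).div_const _
  · simp only [sampleMean]
    rw [integral_div, integral_finsetSum _ fun i _ => hi i]
    simp [integral_eval_comp hlaw, hf]

/-- Of the `n²` products only the `n` diagonal ones contribute; centring one of the two polynomials
already kills the others. -/
theorem integral_sampleMean_eval_mul (hν : ∀ k : ℕ, Integrable (fun x : ℝ => x ^ k) ν)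
    (hlaw : ∀ i, HasLaw (X i) ν P) (hindep : iIndepFun X P) {f g : Polynomial ℝ}
    (hf : ∫ x, f.eval x ∂ν = 0) (n : ℕ) :
    Integrable (fun ω => sampleMean (fun t => f.eval t) n (fun i => X i ω) *
      sampleMean (fun t => g.eval t) n (fun i => X i ω)) P ∧
    ∫ ω, sampleMean (fun t => f.eval t) n (fun i => X i ω) *
      sampleMean (fun t => g.eval t) n (fun i => X i ω) ∂P =
        (∫ x, f.eval x * g.eval x ∂ν) / n := by
  have hif := integrable_eval_comp hν hlaw f
  have hig := integrable_eval_comp hν hlaw g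
  have hfm : Measurable fun x => f.eval x := f.continuous.measurable
  have hgm : Measurable fun x => g.eval x := g.continuous.measurable
  have hint : ∀ i j, Integrable (fun ω => f.eval (X i ω) * g.eval (X j ω)) P := by
    intro i j
    rcases eq_or_ne i j with rfl | hij
    · simpa using integrable_eval_comp hν hlaw (f * g) i
    · exact ((hindep.indepFun hij).comp hfm hgm).integrable_mul (hif i) (hig j)
  have hval : ∀ i j, ∫ ω, f.eval (X i ω) * g.eval (X j ω) ∂P =
      if i = j then ∫ x, f.eval x * g.eval x ∂ν else 0 := by
    intro i j
    split_ifs with hij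
    · subst hij
      simpa using integral_eval_comp hlaw (f * g) i
    · rw [(hindep.indepFun hij).integral_fun_comp_mul_comp (f := fun x => f.eval x)
        (g := fun x => g.eval x) (hlaw i).aemeasurable (hlaw j).aemeasurable
        hfm.aestronglyMeasurable hgm.aestronglyMeasurable, integral_eval_comp hlaw, hf, zero_mul]
  have he : ∀ ω, sampleMean (fun t => f.eval t) n (fun i => X i ω) *
      sampleMean (fun t => g.eval t) n (fun i => X i ω) =
      (∑ i ∈ Finset.range n, ∑ j ∈ Finset.range n, f.eval (X i ω) * g.eval (X j ω)) /
        ((n : ℝ) * n) := by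
    intro ω
    rw [sampleMean, sampleMean, div_mul_div_comm, Finset.sum_mul_sum]
  simp only [he]
  refine ⟨(integrable_finsetSum _ fun i _ => integrable_finsetSum _ fun j _ =>
    hint i j).div_const _, ?_⟩
  rw [integral_div, integral_finsetSum _ fun i _ => integrable_finsetSum _ fun j _ => hint i j]
  have : ∀ i ∈ Finset.range n, ∫ ω, ∑ j ∈ Finset.range n, f.eval (X i ω) * g.eval (X j ω) ∂P =
      ∫ x, f.eval x * g.eval x ∂ν := by
    intro i hi
    rw [integral_finsetSum _ fun j _ => hint i j]
    simp only [hval]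
    rw [Finset.sum_ite_eq, if_pos hi]
  rw [Finset.sum_congr rfl this, Finset.sum_const, Finset.card_range, nsmul_eq_mul]
  rcases Nat.eq_zero_or_pos n with rfl | hn
  · simp
  · field_simp

theorem hasMomentOrder_sampleMean_eval [IsProbabilityMeasure P]
    (hν : ∀ k : ℕ, Integrable (fun x : ℝ => x ^ k) ν)
    (hlaw : ∀ i, HasLaw (X i) ν P) (hindep : iIndepFun X P) {f : Polynomial ℝ}
    (hf : ∫ x, f.eval x ∂ν = 0) :
    HasMomentOrder P 1 fun n ω => sampleMean (fun t => f.eval t) n fun i => X i ω := by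
  refine hasMomentOrder_mean (hindep.comp _ fun _ => f.continuous.measurable)
    (aemeasurable_eval_comp hlaw f) (fun i p => ?_)
    (fun i => (integral_eval_comp hlaw f i).trans hf)
    (fun p => ∫ x, (f ^ (2 * p)).eval x ∂ν) (fun i p => ?_)
  · simpa using integrable_eval_comp hν hlaw (f ^ (2 * p)) i
  · simpa using (integral_eval_comp hlaw (f ^ (2 * p)) i).le

end PolynomialMeans

/-! ### Central moments up to order four. -/

section CentralMoments

variable {μ lam : ℝ}

theorem integral_igMeasure_quartic (hμ : 0 < μ) (hlam : 0 < lam)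
    [IsProbabilityMeasure (igMeasure μ lam)] (a b c d e : ℝ) :
    ∫ x, (a * x ^ 4 + b * x ^ 3 + c * x ^ 2 + d * x + e) ∂(igMeasure μ lam) =
      a * (μ ^ 4 + 6 * μ ^ 5 / lam + 15 * μ ^ 6 / lam ^ 2 + 15 * μ ^ 7 / lam ^ 3) +
      b * (μ ^ 3 + 3 * μ ^ 4 / lam + 3 * μ ^ 5 / lam ^ 2) + c * (μ ^ 2 + μ ^ 3 / lam) +
      d * μ + e := by
  obtain ⟨h2, h3, h4⟩ := integral_igMeasure_moments hμ hlam
  have h1 := integral_igMeasure_id (lam := lam) hμ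
  have I := integrable_pow_igMeasure hμ hlam
  have I1 : Integrable (fun x : ℝ => x) (igMeasure μ lam) := by simpa using I 1
  have J4 := (I 4).const_mul a
  have J3 := (I 3).const_mul b
  have J2 := (I 2).const_mul c
  have J1 := I1.const_mul d
  rw [integral_add (by exact ((J4.add J3).add J2).add J1) (integrable_const _),
    integral_add (by exact (J4.add J3).add J2) J1, integral_add (by exact J4.add J3) J2,
    integral_add J4 J3, integral_const_mul, integral_const_mul, integral_const_mul,
    integral_const_mul, h1, h2, h3, h4]
  simp

theorem integral_igMeasure_central (hμ : 0 < μ) (hlam : 0 < lam)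
    [IsProbabilityMeasure (igMeasure μ lam)] :
    ∫ x, (x - μ) ∂(igMeasure μ lam) = 0 ∧
    ∫ x, ((x - μ) ^ 2 - μ ^ 3 / lam) ∂(igMeasure μ lam) = 0 ∧
    ∫ x, (x - μ) * (x - μ) ∂(igMeasure μ lam) = μ ^ 3 / lam ∧
    ∫ x, (x - μ) * ((x - μ) ^ 2 - μ ^ 3 / lam) ∂(igMeasure μ lam) = 3 * μ ^ 5 / lam ^ 2 ∧
    ∫ x, ((x - μ) ^ 2 - μ ^ 3 / lam) * ((x - μ) ^ 2 - μ ^ 3 / lam) ∂(igMeasure μ lam) =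
      15 * μ ^ 7 / lam ^ 3 + 2 * μ ^ 6 / lam ^ 2 := by
  have Q := integral_igMeasure_quartic hμ hlam
  set s := μ ^ 3 / lam with hs
  refine ⟨?_, ?_, ?_, ?_, ?_⟩
  · refine Eq.trans (integral_congr_ae (ae_of_all _ fun x => ?_)) ((Q 0 0 0 1 (-μ)).trans ?_)
    · ring
    · ring
  · refine Eq.trans (integral_congr_ae (ae_of_all _ fun x => ?_))
      ((Q 0 0 1 (-2 * μ) (μ ^ 2 - s)).trans ?_)
    · ring
    · ring
  · refine Eq.trans (integral_congr_ae (ae_of_all _ fun x => ?_))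
      ((Q 0 0 1 (-2 * μ) (μ ^ 2)).trans ?_)
    · ring
    · ring
  · refine Eq.trans (integral_congr_ae (ae_of_all _ fun x => ?_))
      ((Q 0 1 (-3 * μ) (3 * μ ^ 2 - s) (-μ ^ 3 + s * μ)).trans ?_)
    · ring
    · rw [hs]; field_simp; ring
  · refine Eq.trans (integral_congr_ae (ae_of_all _ fun x => ?_))
      ((Q 1 (-4 * μ) (6 * μ ^ 2 - 2 * s) (-4 * μ ^ 3 + 4 * s * μ)
        (μ ^ 4 - 2 * s * μ ^ 2 + s ^ 2)).trans ?_)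
    · ring
    · rw [hs]; field_simp; ring

end CentralMoments

/-! ### Exact second-order expansion of the moment estimator. -/

noncomputable section

/-- The second-order Taylor polynomial of `(μ + w)³ / (σ² + q - w²) - lam` in `(w, q)`, where
`σ² = μ³ / lam` is the variance of `IG(μ, lam)`. -/
def mmTaylor (μ lam w q : ℝ) : ℝ :=
  (3 * μ ^ 2 * w - lam * q) / (μ ^ 3 / lam) + (3 * μ + lam) * (w * w) / (μ ^ 3 / lam) -
    (3 * μ ^ 2 * (w * q) - lam * (q * q)) / (μ ^ 3 / lam) ^ 2

end

theorem sampleMean_sub_const {n : ℕ} (hn : 1 ≤ n) (h : ℝ → ℝ) (c : ℝ) (x : ℕ → ℝ) :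
    sampleMean (fun t => h t - c) n x = sampleMean h n x - c := by
  have hn0 : (n : ℝ) ≠ 0 := by positivity
  simp only [sampleMean, Finset.sum_sub_distrib, Finset.sum_const, Finset.card_range, nsmul_eq_mul]
  field_simp

theorem sampleMean_sq {n : ℕ} (hn : 1 ≤ n) (μ s : ℝ) (x : ℕ → ℝ) :
    sampleMean (fun t => t ^ 2) n x =
      μ ^ 2 + s + (sampleMean (fun t => (t - μ) ^ 2 - s) n x +
        2 * μ * sampleMean (fun t => t - μ) n x) := by
  have hn0 : (n : ℝ) ≠ 0 := by positivity
  simp only [sampleMean, sub_sq, Finset.sum_sub_distrib, Finset.sum_add_distrib, ← Finset.sum_mul,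
    ← Finset.mul_sum, Finset.sum_const, Finset.card_range, nsmul_eq_mul]
  field_simp
  ring

theorem empiricalVariance_eq {n : ℕ} (hn : 1 ≤ n) (μ s : ℝ) (x : ℕ → ℝ) :
    empiricalVariance n x = s + sampleMean (fun t => (t - μ) ^ 2 - s) n x -
      sampleMean (fun t => t - μ) n x ^ 2 := by
  have hn0 : (n : ℝ) ≠ 0 := by positivity
  have h : sampleMean id n x = μ + sampleMean (fun t => t - μ) n x := by
    rw [sampleMean_sub_const hn (fun t => t)]
    simp [sampleMean]
  rw [empiricalVariance, h]
  simp only [sampleMean, sub_sq, Finset.sum_sub_distrib, Finset.sum_add_distrib, ← Finset.sum_mul,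
    ← Finset.mul_sum, Finset.sum_const, Finset.card_range, nsmul_eq_mul]
  field_simp
  ring

theorem mmEstimator_eq {n : ℕ} (hn : 1 ≤ n) (μ : ℝ) (x : ℕ → ℝ) :
    mmEstimator n x = (μ + sampleMean (fun t => t - μ) n x) ^ 3 / empiricalVariance n x := by
  rw [mmEstimator, sampleMean_sub_const hn (fun t => t)]
  simp [sampleMean]

theorem steinTaylorError_one {μ lam : ℝ} (hμ : 0 < μ) (hlam : 0 < lam)
    [IsProbabilityMeasure (igMeasure μ lam)] {n : ℕ} (hn : 1 ≤ n) (x : ℕ → ℝ) :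
    steinTaylorError (fun _ => 1) μ lam n x = mmTaylor μ lam (sampleMean (fun t => t - μ) n x)
      (sampleMean (fun t => (t - μ) ^ 2 - μ ^ 3 / lam) n x) := by
  have hn0 : (n : ℝ) ≠ 0 := by positivity
  have hs : 0 < μ ^ 3 / lam := by positivity
  have hE : steinZExp (fun _ => 1) μ lam = ![μ, 1, μ, μ ^ 2 + μ ^ 3 / lam, 0] := by
    funext j
    fin_cases j
    · simpa [steinZExp, steinZ] using integral_igMeasure_id hμ
    · simp [steinZExp, steinZ]
    · simpa [steinZExp, steinZ] using integral_igMeasure_id hμ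
    · simpa [steinZExp, steinZ] using (integral_igMeasure_moments hμ hlam).1
    · simp [steinZExp, steinZ]
  have hM : steinZMean (fun _ => 1) n x - ![μ, 1, μ, μ ^ 2 + μ ^ 3 / lam, 0] =
      ![sampleMean (fun t => t - μ) n x, 0, sampleMean (fun t => t - μ) n x,
        sampleMean (fun t => (t - μ) ^ 2 - μ ^ 3 / lam) n x +
          2 * μ * sampleMean (fun t => t - μ) n x, 0] := by
    have h1 := sampleMean_sub_const hn (fun t => t) μ x
    have h2 := sampleMean_sq hn μ (μ ^ 3 / lam) x
    have h3 : sampleMean (fun _ => (1 : ℝ)) n x = 1 := by simp [sampleMean, hn0]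
    have h4 : sampleMean (fun _ => (0 : ℝ)) n x = 0 := by simp [sampleMean]
    funext j
    fin_cases j
    · simp [steinZMean, steinZ, h1]
    · simp [steinZMean, steinZ, h3]
    · simp [steinZMean, steinZ, h1]
    · simp [steinZMean, steinZ, h2]
    · simp [steinZMean, steinZ, h4]
  rw [steinTaylorError, hE, hM, taylorTwo_steinG hs, mmTaylor]
  field_simp
  ring

/-- The remainder of the second-order expansion of the moment estimator. -/
theorem mmTaylor_remainder {μ lam w q v : ℝ} (hμ : 0 < μ) (hlam : 0 < lam)
    (hv : v = μ ^ 3 / lam + q - w ^ 2) (hv0 : v ≠ 0) :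
    (μ + w) ^ 3 / v - lam - mmTaylor μ lam w q =
      (μ ^ 3 / lam)⁻¹ * (w * (w * w)) +
      ((μ ^ 3 / lam) ^ 2)⁻¹ * ((3 * μ ^ 2 * w - lam * q) * (w * w) -
        ((3 * μ + lam) * (w * w) + w * (w * w)) * (q - w * w) +
        (3 * μ ^ 2 * w - lam * q + ((3 * μ + lam) * (w * w) + w * (w * w))) *
          ((q - w * w) * (q - w * w)) * v⁻¹) := by
  -- Peeling off `lam * v` leaves the numerator `N` of the error. With `δ = q - w²` and `s = μ³ /
  -- lam`, the expansion rests on `1 / v = 1 / s - δ / s² + δ² / (s² v)`.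
  have hN : (μ + w) ^ 3 = lam * v +
      (3 * μ ^ 2 * w - lam * q + ((3 * μ + lam) * (w * w) + w * (w * w))) := by
    rw [hv]; field_simp; ring
  have hq : q - w * w = v - μ ^ 3 / lam := by rw [hv]; ring
  have hq' : q = v - μ ^ 3 / lam + w * w := by rw [hv]; ring
  have hs : μ ^ 3 / lam ≠ 0 := by positivity
  rw [hN, mmTaylor, hq, hq']
  generalize μ ^ 3 / lam = s at hs
  field_simp
  ring

theorem aemeasurable_sampleMean {Ω : Type*} [MeasurableSpace Ω] {P : Measure Ω}
    {X : ℕ → Ω → ℝ} (hm : ∀ i, AEMeasurable (X i) P) {h : ℝ → ℝ} (hh : Measurable h)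
    (n : ℕ) : AEMeasurable (fun ω => sampleMean h n fun i => X i ω) P :=
  (Finset.aemeasurable_fun_sum _ fun i _ => hh.comp_aemeasurable (hm i)).div_const _

theorem aemeasurable_mmEstimator {Ω : Type*} [MeasurableSpace Ω] {P : Measure Ω}
    {X : ℕ → Ω → ℝ} (hm : ∀ i, AEMeasurable (X i) P) (n : ℕ) :
    AEMeasurable (fun ω => mmEstimator n fun i => X i ω) P :=
  ((aemeasurable_sampleMean hm measurable_id n).pow_const 3).div
    (aemeasurable_empiricalVariance hm n)

/-! ### Asymptotic normality and bias. -/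

section InverseGaussian

variable {Ω : Type*} [MeasurableSpace Ω] {P : Measure Ω} [IsProbabilityMeasure P]
  {μ lam : ℝ} {X : ℕ → Ω → ℝ}

/-- Normalisation of the density is thus inherited from the data having that law, with no integral
to compute. -/
theorem isProbabilityMeasure_of_hasLaw {ν : Measure ℝ} {Y : Ω → ℝ} (h : HasLaw Y ν P) :
    IsProbabilityMeasure ν := h.isProbabilityMeasure_iff.1 ‹_›

theorem hasMomentOrder_mean_deviation (hμ : 0 < μ) (hlam : 0 < lam)
    (hlaw : ∀ i, HasLaw (X i) (igMeasure μ lam) P) (hindep : iIndepFun X P) :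
    HasMomentOrder P 1 (fun n ω => sampleMean (fun t => t - μ) n fun i => X i ω) ∧
    HasMomentOrder P 1
      (fun n ω => sampleMean (fun t => (t - μ) ^ 2 - μ ^ 3 / lam) n fun i => X i ω) := by
  have := isProbabilityMeasure_of_hasLaw (hlaw 0)
  obtain ⟨c1, c2, -⟩ := integral_igMeasure_central hμ hlam
  have e1 : ∀ x, (Polynomial.X - Polynomial.C μ).eval x = x - μ := fun x => by simp
  have e2 : ∀ x, ((Polynomial.X - Polynomial.C μ) ^ 2 - Polynomial.C (μ ^ 3 / lam)).eval x =
      (x - μ) ^ 2 - μ ^ 3 / lam := fun x => by simp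
  have hν := integrable_pow_igMeasure hμ hlam
  constructor
  · have h := hasMomentOrder_sampleMean_eval hν hlaw hindep
      (f := Polynomial.X - Polynomial.C μ) (by simpa only [e1] using c1)
    simpa only [e1] using h
  · have h := hasMomentOrder_sampleMean_eval hν hlaw hindep
      (f := (Polynomial.X - Polynomial.C μ) ^ 2 - Polynomial.C (μ ^ 3 / lam))
      (by simpa only [e2] using c2)
    simpa only [e2] using h

/-- The linear part is centred. The quadratic part contributes, after multiplication by `n`, `(3μ +
lam) - 9μ + (15μ + 2 lam)`, from the `w²`, `wq` and `q²` terms respectively. -/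
theorem integral_mmTaylor (hμ : 0 < μ) (hlam : 0 < lam)
    (hlaw : ∀ i, HasLaw (X i) (igMeasure μ lam) P) (hindep : iIndepFun X P) (n : ℕ) :
    Integrable (fun ω => mmTaylor μ lam (sampleMean (fun t => t - μ) n fun i => X i ω)
      (sampleMean (fun t => (t - μ) ^ 2 - μ ^ 3 / lam) n fun i => X i ω)) P ∧
    ∫ ω, mmTaylor μ lam (sampleMean (fun t => t - μ) n fun i => X i ω)
      (sampleMean (fun t => (t - μ) ^ 2 - μ ^ 3 / lam) n fun i => X i ω) ∂P =
        3 * (lam + 3 * μ) / n := by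
  have := isProbabilityMeasure_of_hasLaw (hlaw 0)
  obtain ⟨c1, c2, c11, c12, c22⟩ := integral_igMeasure_central hμ hlam
  set f1 : Polynomial ℝ := Polynomial.X - Polynomial.C μ with hf1
  set f2 : Polynomial ℝ := (Polynomial.X - Polynomial.C μ) ^ 2 - Polynomial.C (μ ^ 3 / lam) with hf2
  have e1 : ∀ x, f1.eval x = x - μ := fun x => by simp [hf1]
  have e2 : ∀ x, f2.eval x = (x - μ) ^ 2 - μ ^ 3 / lam := fun x => by simp [hf2]
  have hν := integrable_pow_igMeasure hμ hlam
  have z1 : ∫ x, f1.eval x ∂(igMeasure μ lam) = 0 := by simpa only [e1] using c1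
  have z2 : ∫ x, f2.eval x ∂(igMeasure μ lam) = 0 := by simpa only [e2] using c2
  have m1 := integral_sampleMean_eval hν hlaw z1 n
  have m2 := integral_sampleMean_eval hν hlaw z2 n
  have m11 := integral_sampleMean_eval_mul hν hlaw hindep (f := f1) (g := f1) z1 n
  have m12 := integral_sampleMean_eval_mul hν hlaw hindep (f := f1) (g := f2) z1 n
  have m22 := integral_sampleMean_eval_mul hν hlaw hindep (f := f2) (g := f2) z2 n
  simp only [e1, e2, c11, c12, c22] at m1 m2 m11 m12 m22
  set W : Ω → ℝ := fun ω => sampleMean (fun t => t - μ) n fun i => X i ω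
  set Q : Ω → ℝ := fun ω => sampleMean (fun t => (t - μ) ^ 2 - μ ^ 3 / lam) n fun i => X i ω
  have i1 : Integrable (fun ω => (3 * μ ^ 2 * W ω - lam * Q ω) / (μ ^ 3 / lam)) P :=
    ((m1.1.const_mul _).sub (m2.1.const_mul _)).div_const _
  have i2 : Integrable (fun ω => (3 * μ + lam) * (W ω * W ω) / (μ ^ 3 / lam)) P :=
    (m11.1.const_mul _).div_const _
  have i3 : Integrable (fun ω => (3 * μ ^ 2 * (W ω * Q ω) - lam * (Q ω * Q ω)) /
      (μ ^ 3 / lam) ^ 2) P :=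
    ((m12.1.const_mul _).sub (m22.1.const_mul _)).div_const _
  refine ⟨(i1.add i2).sub i3, ?_⟩
  have e : ∫ ω, mmTaylor μ lam (W ω) (Q ω) ∂P =
      (3 * μ ^ 2 * 0 - lam * 0) / (μ ^ 3 / lam) + (3 * μ + lam) * (μ ^ 3 / lam / n) / (μ ^ 3 / lam) -
      (3 * μ ^ 2 * (3 * μ ^ 5 / lam ^ 2 / n) -
        lam * ((15 * μ ^ 7 / lam ^ 3 + 2 * μ ^ 6 / lam ^ 2) / n)) / (μ ^ 3 / lam) ^ 2 := by
    simp only [mmTaylor]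
    rw [integral_sub (by exact i1.add i2) i3, integral_add i1 i2, integral_div, integral_div,
      integral_div, integral_sub (m1.1.const_mul _) (m2.1.const_mul _), integral_const_mul,
      integral_const_mul, integral_const_mul, m1.2, m2.2, m11.2,
      integral_sub (m12.1.const_mul _) (m22.1.const_mul _), integral_const_mul, integral_const_mul,
      m12.2, m22.2]
  refine e.trans ?_
  rcases Nat.eq_zero_or_pos n with rfl | hn
  · simp
  · field_simp
    ring

/-- Orders add under products: each term of `mmTaylor_remainder` has total order at least three,
with `v⁻¹` counting as order zero. -/
theorem hasMomentOrder_mmEstimator_remainder (hμ : 0 < μ) (hlam : 0 < lam)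
    (hlaw : ∀ i, HasLaw (X i) (igMeasure μ lam) P) (hindep : iIndepFun X P) :
    HasMomentOrder P 3 fun n ω => mmEstimator n (fun i => X i ω) - lam -
      mmTaylor μ lam (sampleMean (fun t => t - μ) n fun i => X i ω)
        (sampleMean (fun t => (t - μ) ^ 2 - μ ^ 3 / lam) n fun i => X i ω) := by
  have := isProbabilityMeasure_of_hasLaw (hlaw 0)
  obtain ⟨C, hC⟩ := exists_igMeasure_le hμ hlam
  obtain ⟨hW, hQ⟩ := hasMomentOrder_mean_deviation hμ hlam hlaw hindep
  have hVinv := (momentBounded_inv_empiricalVariance hC hlaw hindep).hasMomentOrder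
  have hm : ∀ i, AEMeasurable (X i) P := fun i => (hlaw i).aemeasurable
  have hmW := fun n => aemeasurable_sampleMean hm (h := fun t => t - μ) (by fun_prop) n
  have hmQ := fun n => aemeasurable_sampleMean hm
    (h := fun t => (t - μ) ^ 2 - μ ^ 3 / lam) (by fun_prop) n
  have hmR : ∀ n, AEMeasurable (fun ω => mmEstimator n (fun i => X i ω) - lam -
      mmTaylor μ lam (sampleMean (fun t => t - μ) n fun i => X i ω)
        (sampleMean (fun t => (t - μ) ^ 2 - μ ^ 3 / lam) n fun i => X i ω)) P := fun n => by
    refine ((aemeasurable_mmEstimator hm n).sub_const _).sub ?_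
    simp only [mmTaylor]
    have := hmW n
    have := hmQ n
    fun_prop
  have hWW := hW.mul hW
  have hWWW := hW.mul hWW
  have hL := (hW.const_mul (3 * μ ^ 2)).sub (hQ.const_mul lam)
  have hN2 := (hWW.const_mul (3 * μ + lam)).add
    (hWWW.mono (by norm_num) fun n => (hmW n).mul ((hmW n).mul (hmW n)))
  have hδ := hQ.sub (hWW.mono (by norm_num) fun n => (hmW n).mul (hmW n))
  have hN := hL.add (hN2.mono (a := 1) (by norm_num) fun n =>
    (((hmW n).mul (hmW n)).const_mul _).add ((hmW n).mul ((hmW n).mul (hmW n))))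
  have hR := (hWWW.const_mul (μ ^ 3 / lam)⁻¹).add
    ((((hL.mul hWW).sub (hN2.mul hδ)).add ((hN.mul (hδ.mul hδ)).mul hVinv)).const_mul
      ((μ ^ 3 / lam) ^ 2)⁻¹)
  have hne : ∀ᵐ ω ∂P, ∀ j, X (2 * j) ω ≠ X (2 * j + 1) ω :=
    ae_all_iff.2 fun j => ae_ne_of_hasLaw hC hlaw hindep (by omega)
  refine MomentBounded.mono hR (fun n => (hmR n).const_mul _) ?_
  filter_upwards [eventually_ge_atTop 2] with n hn
  filter_upwards [hne] with ω hω
  -- Only positivity of the empirical variance is needed, so the exponent `0` is arbitrary.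
  have hV := (inv_empiricalVariance_pow_le hn (fun i => X i ω) hω 0).1
  have hn1 : 1 ≤ n := by omega
  rw [mmEstimator_eq hn1 μ, mmTaylor_remainder hμ hlam
    (empiricalVariance_eq hn1 μ (μ ^ 3 / lam) fun i => X i ω) hV.ne']

theorem tendstoInDistribution_sqrt_mul_sampleMean_eval {ν : Measure ℝ}
    (hν : ∀ k : ℕ, Integrable (fun x : ℝ => x ^ k) ν)
    (hlaw : ∀ i, HasLaw (X i) ν P) (hindep : iIndepFun X P) {f : Polynomial ℝ}
    (hf : ∫ x, f.eval x ∂ν = 0) :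
    TendstoInDistribution
      (fun (n : ℕ) ω => Real.sqrt n * sampleMean (fun t => f.eval t) n (fun i => X i ω)) atTop
      (id : ℝ → ℝ) (fun _ => P) (gaussianReal 0 (∫ x, f.eval x * f.eval x ∂ν).toNNReal) := by
  have hfm : Measurable fun x => f.eval x := f.continuous.measurable
  have h0 : ∫ ω, f.eval (X 0 ω) ∂P = 0 := (integral_eval_comp hlaw f 0).trans hf
  have hvar : Var[fun ω => f.eval (X 0 ω); P] = ∫ x, f.eval x * f.eval x ∂ν := by
    rw [variance_of_integral_eq_zero (aemeasurable_eval_comp hlaw f 0) h0]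
    simpa [sq] using integral_eval_comp hlaw (f * f) 0
  have hsq : Integrable (fun ω => f.eval (X 0 ω) ^ 2) P :=
    (integrable_eval_comp hν hlaw (f ^ 2) 0).congr (ae_of_all _ fun _ => Polynomial.eval_pow 2)
  have h := tendstoInDistribution_inv_sqrt_mul_sum_sub (P := P)
    (X := fun i ω => f.eval (X i ω)) (Y := (id : ℝ → ℝ))
    (P' := gaussianReal 0 (∫ x, f.eval x * f.eval x ∂ν).toNNReal)
    (by rw [hvar]; exact HasLaw.id)
    ((memLp_two_iff_integrable_sq (aemeasurable_eval_comp hlaw f 0).aestronglyMeasurable).2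
      hsq)
    (hindep.comp _ fun _ => hfm)
    (fun i => by
      have : IdentDistrib (X i) (X 0) P P :=
        ⟨(hlaw i).aemeasurable, (hlaw 0).aemeasurable, by rw [(hlaw i).map_eq, (hlaw 0).map_eq]⟩
      exact this.comp hfm)
  convert h using 3 with n ω
  simp only [h0, mul_zero, sub_zero, sampleMean]
  rcases Nat.eq_zero_or_pos n with rfl | hn
  · simp
  · have hn0 : (0 : ℝ) < n := by exact_mod_cast hn
    rw [mul_div_assoc', mul_comm, mul_div_assoc, Real.sqrt_div_self, mul_comm]

theorem tendstoInDistribution_mmEstimator (hμ : 0 < μ) (hlam : 0 < lam)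
    (hlaw : ∀ i, HasLaw (X i) (igMeasure μ lam) P) (hindep : iIndepFun X P) :
    TendstoInDistribution
      (fun (n : ℕ) ω => Real.sqrt n * (mmEstimator n (fun i => X i ω) - lam)) atTop
      (id : ℝ → ℝ) (fun _ => P)
      (gaussianReal 0 (Real.toNNReal (2 * lam * (lam + 3 * μ)))) := by
  have := isProbabilityMeasure_of_hasLaw (hlaw 0)
  obtain ⟨hW, hQ⟩ := hasMomentOrder_mean_deviation hμ hlam hlaw hindep
  have hR := hasMomentOrder_mmEstimator_remainder hμ hlam hlaw hindep
  have hν := integrable_pow_igMeasure hμ hlam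
  have hm : ∀ i, AEMeasurable (X i) P := fun i => (hlaw i).aemeasurable
  set s := μ ^ 3 / lam with hs
  -- The influence function of the estimator: its sample mean is the linear part of `mmTaylor`.
  set f : Polynomial ℝ := Polynomial.C (3 * μ ^ 2 / s) * (Polynomial.X - Polynomial.C μ) -
    Polynomial.C (lam / s) * ((Polynomial.X - Polynomial.C μ) ^ 2 - Polynomial.C s) with hf
  have he : ∀ x, f.eval x = 3 * μ ^ 2 / s * (x - μ) - lam / s * ((x - μ) ^ 2 - s) := fun x => by
    simp [hf]
  have hmean : ∫ x, f.eval x ∂(igMeasure μ lam) = 0 := by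
    refine Eq.trans (integral_congr_ae (ae_of_all _ fun x => ?_))
      ((integral_igMeasure_quartic hμ hlam 0 0 (-(lam / s)) (3 * μ ^ 2 / s + 2 * μ * (lam / s))
        (-(3 * μ ^ 2 / s * μ) - lam / s * (μ ^ 2 - s))).trans ?_)
    · simp only [he]; ring
    · rw [← hs]; ring
  have hvar : ∫ x, f.eval x * f.eval x ∂(igMeasure μ lam) = 2 * lam * (lam + 3 * μ) := by
    have hc : ∀ c d : ℝ, ∫ x, (c * (x - μ) - d * ((x - μ) ^ 2 - s)) *
        (c * (x - μ) - d * ((x - μ) ^ 2 - s)) ∂(igMeasure μ lam) =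
        c ^ 2 * s - 2 * c * d * (3 * μ ^ 5 / lam ^ 2) +
          d ^ 2 * (15 * μ ^ 7 / lam ^ 3 + 2 * μ ^ 6 / lam ^ 2) := by
      intro c d
      have Q := integral_igMeasure_quartic hμ hlam (d ^ 2) (-4 * μ * d ^ 2 - 2 * c * d)
        (c ^ 2 + 6 * μ * (c * d) + d ^ 2 * (6 * μ ^ 2 - 2 * s))
        (-2 * μ * c ^ 2 - 2 * c * d * (3 * μ ^ 2 - s) + d ^ 2 * (-4 * μ ^ 3 + 4 * s * μ))
        (c ^ 2 * μ ^ 2 - 2 * c * d * (-μ ^ 3 + s * μ) + d ^ 2 * (μ ^ 2 - s) ^ 2)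
      refine Eq.trans (integral_congr_ae (ae_of_all _ fun x => ?_)) (Q.trans ?_)
      · ring
      · rw [hs]; field_simp; ring
    simp only [he, hc]
    rw [hs]
    field_simp
    ring
  have hclt := tendstoInDistribution_sqrt_mul_sampleMean_eval hν hlaw hindep hmean
  rw [hvar] at hclt
  have hrest : HasMomentOrder P 2 fun n ω => mmEstimator n (fun i => X i ω) - lam -
      sampleMean (fun t => f.eval t) n (fun i => X i ω) := by
    have hmR : ∀ n, AEMeasurable (fun ω => mmEstimator n (fun i => X i ω) - lam -
        mmTaylor μ lam (sampleMean (fun t => t - μ) n fun i => X i ω)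
        (sampleMean (fun t => (t - μ) ^ 2 - s) n fun i => X i ω)) P := fun n => by
      have := aemeasurable_mmEstimator hm n
      have := aemeasurable_sampleMean hm (h := fun t => t - μ) (by fun_prop) n
      have := aemeasurable_sampleMean hm (h := fun t => (t - μ) ^ 2 - s) (by fun_prop) n
      simp only [mmTaylor]
      fun_prop
    have h := (hR.mono (a := 2) (by norm_num) hmR).add
      (((hW.mul hW).const_mul ((3 * μ + lam) / s)).sub
        (((hW.mul hQ).const_mul (3 * μ ^ 2 / s ^ 2)).sub ((hQ.mul hQ).const_mul (lam / s ^ 2))))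
    convert h using 3 with n ω
    have hlin : sampleMean (fun t => f.eval t) n (fun i => X i ω) =
        3 * μ ^ 2 / s * sampleMean (fun t => t - μ) n (fun i => X i ω) -
          lam / s * sampleMean (fun t => (t - μ) ^ 2 - s) n (fun i => X i ω) := by
      simp only [sampleMean, he]
      rw [Finset.sum_sub_distrib, ← Finset.mul_sum, ← Finset.mul_sum]
      ring
    rw [hlin, mmTaylor, ← hs]
    ring
  have hscaled : HasMomentOrder P 1 fun n ω => Real.sqrt n * (mmEstimator n (fun i => X i ω) - lam -
      sampleMean (fun t => f.eval t) n (fun i => X i ω)) := by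
    simpa only [HasMomentOrder, pow_succ, pow_zero, one_mul, mul_assoc] using hrest
  -- Slutsky: what remains after the linear part has order two, hence order one after multiplication
  -- by `√n`, and vanishes in probability.
  refine tendstoInDistribution_of_tendstoInMeasure_sub _ _ hclt ?_ fun n =>
    ((aemeasurable_mmEstimator hm n).sub_const _).const_mul _
  refine (hscaled.tendstoInMeasure).congr_left fun n => ae_of_all _ fun ω => ?_
  simp only [Pi.sub_apply]
  ring

/-- The Taylor polynomial supplies the whole `1 / n` term, and a remainder of order three has
expectation `O(n^(-3/2))`. -/
theorem bias_mmEstimator (hμ : 0 < μ) (hlam : 0 < lam)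
    (hlaw : ∀ i, HasLaw (X i) (igMeasure μ lam) P) (hindep : iIndepFun X P) :
    (∀ᶠ n : ℕ in atTop, Integrable (fun ω => mmEstimator n (fun i => X i ω)) P) ∧
    (fun n : ℕ => (∫ ω, mmEstimator n (fun i => X i ω) ∂P) - lam - 3 * (lam + 3 * μ) / n)
      =o[atTop] (fun n : ℕ => 1 / (n : ℝ)) := by
  have hT := integral_mmTaylor hμ hlam hlaw hindep
  obtain ⟨hRi, C, hRb⟩ :=
    (hasMomentOrder_mmEstimator_remainder hμ hlam hlaw hindep).integrable_and_integral_le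
  have hint : ∀ᶠ n : ℕ in atTop, Integrable (fun ω => mmEstimator n (fun i => X i ω)) P := by
    filter_upwards [hRi] with n hn
    refine ((hn.add (hT n).1).add (integrable_const lam)).congr (ae_of_all _ fun ω => ?_)
    simp only [Pi.add_apply]
    ring
  refine ⟨hint, ?_⟩
  rw [Asymptotics.isLittleO_iff]
  intro c hc
  have hlarge : ∀ᶠ n : ℕ in atTop, C / c ≤ Real.sqrt n :=
    (Real.tendsto_sqrt_atTop.comp tendsto_natCast_atTop_atTop).eventually_ge_atTop _
  filter_upwards [hint, hRb, hlarge, eventually_ge_atTop 1] with n hi hb hl hn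
  have hn0 : (0 : ℝ) < n := by exact_mod_cast hn
  rw [integral_sub (by exact hi.sub (integrable_const _)) (hT n).1,
    integral_sub hi (integrable_const _), (hT n).2] at hb
  simp only [integral_const, probReal_univ, smul_eq_mul, one_mul] at hb
  rw [Real.norm_eq_abs, Real.norm_of_nonneg (by positivity), mul_one_div, le_div_iff₀ hn0]
  have hs0 : 0 < Real.sqrt n := Real.sqrt_pos.2 hn0
  have h3 : Real.sqrt n ^ 3 = n * Real.sqrt n := by
    rw [pow_succ, Real.sq_sqrt hn0.le]
  rw [div_le_iff₀ hc] at hl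
  rw [h3] at hb
  refine le_of_mul_le_mul_right ?_ hs0
  linarith

end InverseGaussian

theorem mainTheorem8 {Ω : Type*} [MeasurableSpace Ω] (P : Measure Ω) [IsProbabilityMeasure P]
    (μ lam : ℝ) (hμ : 0 < μ) (hlam : 0 < lam) (X : ℕ → Ω → ℝ)
    (hlaw : ∀ i, HasLaw (X i) (igMeasure μ lam) P) (hindep : iIndepFun X P) :
    -- the moment estimator is the Stein-type estimator with constant weight function one
    (∀ (n : ℕ) (x : ℕ → ℝ), steinEstimator (fun _ => 1) n x = mmEstimator n x) ∧
    -- asymptotic normality, with asymptotic variance `2 lam (lam + 3 μ) / n`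
    TendstoInDistribution
      (fun (n : ℕ) ω => Real.sqrt n * (mmEstimator n (fun i => X i ω) - lam)) atTop
      (id : ℝ → ℝ) (fun _ => P)
      (gaussianReal 0 (Real.toNNReal (2 * lam * (lam + 3 * μ)))) ∧
    -- asymptotic bias: expectation of the second-order Taylor approximation of the error
    (∀ n : ℕ, 1 ≤ n →
      Integrable (fun ω => steinTaylorError (fun _ => 1) μ lam n (fun i => X i ω)) P ∧
      ∫ ω, steinTaylorError (fun _ => 1) μ lam n (fun i => X i ω) ∂P
        = 3 * (lam + 3 * μ) / n) ∧
    -- the actual bias agrees with it up to `o(1/n)`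
    (∀ᶠ n : ℕ in atTop, Integrable (fun ω => mmEstimator n (fun i => X i ω)) P) ∧
    (fun n : ℕ => (∫ ω, mmEstimator n (fun i => X i ω) ∂P) - lam - 3 * (lam + 3 * μ) / n)
      =o[atTop] (fun n : ℕ => 1 / (n : ℝ)) := by
  have := isProbabilityMeasure_of_hasLaw (hlaw 0)
  refine ⟨steinEstimator_one, tendstoInDistribution_mmEstimator hμ hlam hlaw hindep,
    fun n hn => ?_, bias_mmEstimator hμ hlam hlaw hindep⟩
  simp only [steinTaylorError_one hμ hlam hn]
  exact integral_mmTaylor hμ hlam hlaw hindep n
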